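/- All potentials are measurable radial functions $v:\mathbb R^2\to[0,\infty]$. If $v$ is compactly supported, its scattering length $a(v)\ge 0$ is defined by $$\frac{2\pi}{\log(\widetilde R/a(v))}=\inf\Big\{\int_{B(0,\widetilde R)}\Big(|\nabla\varphi|^2+\tfrac12 v\varphi^2\Big)dx\ :\ \varphi\in H^1(B(0,\widetilde R)),\ \varphi|_{\partial B(0,\widetilde R)}=1\Big\},\qquad a(v)<\widetilde R,$$ where $\widetilde R>0$ is any number such that, for some $r\in[0,\widetilde R)$, $v(x)=0$ whenever $|x|\ge r$ (the value $a(v)$ does not depend on $\widetilde R$). Otherwise $a(v)=\lim_{n\to\infty}a(v\mathbf 1_{B(0,n)})$. Whenever $a(v)=0$, which happens only if $v=0$ almost everywhere, $\log(s/a(v))$ is read as $+\infty$ for every $s>0$, so that $\frac{2\pi}{\log(s/a(v))}=\frac1{\log(s/a(v))^{2}}=0$, and $0\cdot\infty=0$. **Theorem 3.5.** Let $v:\mathbb R^2\to[0,\infty]$ be measurable and radial with finite scattering length $a$. For every $R>a$ and all $T,\varepsilon>0$ there is a measurable radial potential $v_{T,R,\varepsilon}:\mathbb R^2\to[0,\infty]$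 such that $$\operatorname{supp}(v_{T,R,\varepsilon})\subset B(0,R),\qquad 0\le v_{T,R,\varepsilon}(x)\le v(x)\ \text{ for all }x\in\mathbb R^2,\qquad \int_{\mathbb R^2} v_{T,R,\varepsilon}\,dx\le 4\pi T,$$ where $\operatorname{supp}$ is the closed support and $B(0,R)$ the open ball, and such that its scattering length $a_{T,R,\varepsilon}$ satisfies $$\frac{2\pi}{\log(R/a)}-\frac{2\pi}{\log(R/a_{T,R,\varepsilon})}\le\frac1{\log(R/a)^2}\left(\frac{2\pi}{T}(1+\varepsilon)+\frac12\int_{\{|x|>R\}}v(x)\log\Big(\frac{|x|}{a}\Big)^2dx\right).$$ -/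

import Mathlib

open MeasureTheory Filter Topology Set
open scoped ENNReal ContDiff

/-- The Euclidean plane `ℝ²`. -/
abbrev Plane : Type := EuclideanSpace ℝ (Fin 2)

/-- A potential `v : ℝ² → [0, ∞]` is radial if `v x` depends only on `|x|`. -/
def IsRadial (v : Plane → ℝ≥0∞) : Prop :=
  ∀ x y : Plane, ‖x‖ = ‖y‖ → v x = v y

/-- `ψ ∈ C_c^∞(Ω)`, real valued. -/
structure IsTestFunctionOn (Ω : Set Plane) (ψ : Plane → ℝ) : Prop where
  contDiff : ContDiff ℝ ∞ ψ
  hasCompactSupport : HasCompactSupport ψ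
  tsupport_subset : tsupport ψ ⊆ Ω

/-- `φ ∈ H¹(Ω)` with weak gradient `g`: both are square integrable on `Ω`, and
`∫_Ω φ ∇ψ = - ∫_Ω ψ g` for all `ψ ∈ C_c^∞(Ω)`. -/
structure HasH1Gradient (Ω : Set Plane) (φ : Plane → ℝ) (g : Plane → Plane) : Prop where
  memLp : MemLp φ 2 (volume.restrict Ω)
  memLp_grad : MemLp g 2 (volume.restrict Ω)
  weak : ∀ ψ : Plane → ℝ, IsTestFunctionOn Ω ψ →
    ∫ x in Ω, φ x • gradient ψ x = - ∫ x in Ω, ψ x • g x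

/-- For `φ ∈ H¹(Ω)` with weak gradient `g`: the boundary condition `φ = c` on `∂Ω`, in the usual
Sobolev sense `φ - c ∈ H¹₀(Ω)`, where `H¹₀(Ω)` is the closure of `C_c^∞(Ω)` in the `H¹` norm. -/
def HasBoundaryValue (Ω : Set Plane) (φ : Plane → ℝ) (g : Plane → Plane) (c : ℝ) : Prop :=
  ∃ ψ : ℕ → Plane → ℝ, (∀ k, IsTestFunctionOn Ω (ψ k)) ∧
    Tendsto (fun k => eLpNorm (fun x => φ x - c - ψ k x) 2 (volume.restrict Ω)) atTop (𝓝 0) ∧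
    Tendsto (fun k => eLpNorm (fun x => g x - gradient (ψ k) x) 2 (volume.restrict Ω))
      atTop (𝓝 0)

/-- The infimum, in `[0, ∞]`, of `∫_{B(0,ρ)} (|∇φ|² + ½ v φ²)` over `φ ∈ H¹(B(0,ρ))` with
`φ = 1` on `∂B(0,ρ)`.  In `[0, ∞]`, `∞ * 0 = 0`, as usual where `v = ∞` and `φ = 0`. -/
noncomputable def scatteringEnergy (v : Plane → ℝ≥0∞) (ρ : ℝ) : ℝ≥0∞ :=
  ⨅ (φ : Plane → ℝ) (g : Plane → Plane) (_ : HasH1Gradient (Metric.ball 0 ρ) φ g)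
    (_ : HasBoundaryValue (Metric.ball 0 ρ) φ g 1),
    ∫⁻ x in Metric.ball (0 : Plane) ρ, (‖g x‖ₑ ^ 2 + (1 / 2) * v x * ‖φ x‖ₑ ^ 2)

/-- `v x = 0` whenever `|x| ≥ r`. -/
def VanishesBeyond (v : Plane → ℝ≥0∞) (r : ℝ) : Prop :=
  ∀ x : Plane, r ≤ ‖x‖ → v x = 0

/-- `v` vanishes outside of some ball. -/
def IsCompactlySupported (v : Plane → ℝ≥0∞) : Prop :=
  ∃ r : ℝ, 0 ≤ r ∧ VanishesBeyond v r

/-- `a` is the scattering length of the compactly supported potential `v`: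
`2π / log (ρ / a)` is the infimum `scatteringEnergy v ρ`, for every `ρ` that is larger than the
radius of the support of `v`.  Here `0 ≤ a < ρ`; for `a = 0` the left hand side means
`2π / ∞ = 0`, and this is also the value of the Lean term. -/
structure HasCompactScatteringLength (v : Plane → ℝ≥0∞) (a : ℝ) : Prop where
  compact : IsCompactlySupported v
  nonneg : 0 ≤ a
  lt : ∀ r ρ : ℝ, 0 ≤ r → VanishesBeyond v r → r < ρ → a < ρ
  energy : ∀ r ρ : ℝ, 0 ≤ r → VanishesBeyond v r → r < ρ →
    scatteringEnergy v ρ = ENNReal.ofReal (2 * Real.pi / Real.log (ρ / a))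

/-- `v` has the finite scattering length `a`.  If `v` is not compactly supported, this means that
`a` is the limit of the scattering lengths of the truncations of `v` to the balls `B(0,n)`. -/
def HasScatteringLength (v : Plane → ℝ≥0∞) (a : ℝ) : Prop :=
  HasCompactScatteringLength v a ∨
    (¬ IsCompactlySupported v ∧ ∃ α : ℕ → ℝ,
      (∀ n : ℕ, HasCompactScatteringLength ((Metric.ball (0 : Plane) n).indicator v) (α n)) ∧
      Tendsto α atTop (𝓝 a))

/-! A bounded radial potential `w` living in an annulus is governed by an ODE. Put `q t = t * w /
2`, let `u = 1` near the origin and `(t u')' = q u`, and let `h = t u'` be the flux, which is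
constant, equal to `H`, beyond the support of `w`. Then `u / u ρ` minimizes the energy of `w` on
`B(0, ρ)`, the minimum is `2πH / u ρ`, and hence `log (ρ / a') = u ρ / H`. Since `u ≥ 1`, also `H ≥
∫ q = (4π)⁻¹ ∫ w`.

Given `v`, fix `r < R` close to `R` and move inward from `r` until the mass of `v` reaches `4πT`, at
radius `r₀`. The potential `w` nearly equals `v` on `r₀ < |x| < r`. If `r₀ > 0`, mass from a thin
shell just inside `r₀` is added to make the total exactly `4πT`, so that `H ≥ T`
(`exists_truncation`). The true `v` may be arbitrarily large inside `r₀`, so the trial function for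
`v` is `(u - u r₀) / (u R - u r₀)`, cut to zero there. By `lintegral_energy_cutSolution_le` its
energy is at most `2πH / (u R - u r₀) = 2π / (log (R / a') - C)` with `C = u r₀ / H`, plus the small
mass of `v - w` on `r₀ < |x| < R`. As `u` is `1` at the inner edge of the thin shell and `t u' ≤ H`,
`C ≤ 1/T + log (1 + δ)`. An elementary inequality (`ofReal_two_pi_div_sub_le`) turns the shift `C`
in the denominator into the error `2πC / log (R / a)²`.

The part of `v` outside `B(0, R)` enters through
`HasCompactScatteringLength.two_pi_div_log_le_of_trial`: the trial function is continued by a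
multiple of `log (|x| / α)`, and the cost of this is the tail integral. A limit over truncations
removes the compact support. The case `a = 0` is settled by `w = 0`. -/

/-! ### Polar coordinates in the plane. -/

section Polar

theorem lintegral_plane_norm {f : ℝ → ℝ≥0∞} (hf : Measurable f) :
    ∫⁻ x : Plane, f ‖x‖ = ENNReal.ofReal (2 * Real.pi) *
      ∫⁻ r in Ioi (0 : ℝ), ENNReal.ofReal r * f r := by
  calc
    ∫⁻ x : Plane, f ‖x‖ = ∫⁻ x : ({(0)}ᶜ : Set Plane), f (‖x.1‖) ∂(volume.comap Subtype.val) := by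
      rw [lintegral_subtype_comap (measurableSet_singleton _).compl fun x ↦ f (‖x‖),
        restrict_compl_singleton]
    _ = ∫⁻ x, f x.2 ∂(volume : Measure Plane).toSphere.prod
          (.volumeIoiPow (Module.finrank ℝ Plane - 1)) := by
      rw [← (volume : Measure Plane).measurePreserving_homeomorphUnitSphereProd.lintegral_comp_emb
        (Homeomorph.measurableEmbedding _)]
      simp
    _ = _ := by
      rw [lintegral_prod _ (by fun_prop)]
      simp only [lintegral_const, Measure.toSphere_apply_univ, finrank_euclideanSpace,
        Fintype.card_fin, Nat.add_one_sub_one]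
      rw [Measure.volumeIoiPow, lintegral_withDensity_eq_lintegral_mul _ (by fun_prop)
        (by fun_prop), mul_comm]
      congr 1
      · rw [EuclideanSpace.volume_ball_fin_two]
        simp [ENNReal.ofReal_mul, ← NNReal.coe_real_pi]
      · rw [← lintegral_subtype_comap measurableSet_Ioi]
        simp

theorem integral_plane_polar {G : Plane → ℝ} (hG : Integrable G) :
    ∫ x, G x = ∫ θ, (∫ r in Ioi (0 : ℝ), r * G (r • (θ : Plane)))
      ∂(volume : Measure Plane).toSphere := by
  have hm := (volume : Measure Plane).measurePreserving_homeomorphUnitSphereProd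
  let G' : Metric.sphere (0 : Plane) 1 × Ioi (0 : ℝ) → ℝ := fun z => G (z.2.1 • (z.1 : Plane))
  have hcomp : ∀ x : ({(0)}ᶜ : Set Plane), G' (homeomorphUnitSphereProd Plane x) = G x := by
    rintro ⟨x, hx⟩
    have : ‖x‖ ≠ 0 := by simpa using hx
    simp [G', smul_smul, this]
  have hint : Integrable G' ((volume : Measure Plane).toSphere.prod
      (.volumeIoiPow (Module.finrank ℝ Plane - 1))) := by
    rw [← hm.integrable_comp_emb (Homeomorph.measurableEmbedding _)]
    have : G' ∘ (homeomorphUnitSphereProd Plane) = G ∘ Subtype.val := by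
      ext x; exact hcomp x
    rw [this, ← integrableOn_iff_comap_subtypeVal (by measurability)]
    exact hG.integrableOn
  calc
    ∫ x, G x = ∫ x : ({(0)}ᶜ : Set Plane), G x ∂(volume.comap Subtype.val) := by
      rw [integral_subtype_comap (measurableSet_singleton _).compl fun x ↦ G x,
        restrict_compl_singleton]
    _ = ∫ z, G' z ∂(volume : Measure Plane).toSphere.prod
          (.volumeIoiPow (Module.finrank ℝ Plane - 1)) := by
      rw [← hm.integral_comp (Homeomorph.measurableEmbedding _)]
      simp_rw [hcomp]
    _ = _ := by
      rw [integral_prod _ hint]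
      congr 1 with θ
      simp only [finrank_euclideanSpace, Fintype.card_fin, Nat.add_one_sub_one, G']
      simp only [Measure.volumeIoiPow, ENNReal.ofReal]
      rw [integral_withDensity_eq_integral_smul (by fun_prop),
        integral_subtype_comap measurableSet_Ioi
          fun a : ℝ ↦ Real.toNNReal (a ^ 1) • G (a • (θ : Plane))]
      refine setIntegral_congr_fun measurableSet_Ioi fun x hx ↦ ?_
      simp only [pow_one]
      rw [NNReal.smul_def, Real.coe_toNNReal _ (le_of_lt hx), smul_eq_mul]

theorem integral_plane_norm (f : ℝ → ℝ) :
    ∫ x : Plane, f ‖x‖ = 2 * Real.pi * ∫ r in Ioi (0 : ℝ), r * f r := by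
  rw [integral_fun_norm_addHaar]
  simp [Measure.real, EuclideanSpace.volume_ball_fin_two, mul_assoc, Real.pi_pos.le]

theorem integral_ball_norm (f : ℝ → ℝ) {ρ : ℝ} :
    ∫ x in Metric.ball (0 : Plane) ρ, f ‖x‖ = 2 * Real.pi * ∫ r in Ioo (0 : ℝ) ρ, r * f r := by
  have h1 : ∀ x : Plane, (Metric.ball (0 : Plane) ρ).indicator (fun x => f ‖x‖) x =
      (Iio ρ).indicator f ‖x‖ := by
    intro x; simp [indicator]
  rw [← integral_indicator measurableSet_ball]
  simp_rw [h1]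
  rw [integral_plane_norm]
  congr 1
  have : ∀ r, r * (Iio ρ).indicator f r = (Iio ρ).indicator (fun r => r * f r) r := by
    intro r; simp [indicator]
  simp_rw [this]
  rw [setIntegral_indicator measurableSet_Iio]
  rfl

theorem ae_plane_norm {P : ℝ → Prop} (hP : ∀ᵐ r : ℝ, P r) : ∀ᵐ x : Plane, P ‖x‖ := by
  set N := toMeasurable volume {r | ¬ P r}
  have hN : volume N = 0 := by rw [measure_toMeasurable]; exact hP
  have hmN : MeasurableSet N := measurableSet_toMeasurable _ _
  have h := lintegral_plane_norm (f := N.indicator 1) (measurable_one.indicator hmN)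
  have h0 : ∫⁻ r in Ioi (0 : ℝ), ENNReal.ofReal r * N.indicator 1 r = 0 := by
    rw [lintegral_eq_zero_iff (by fun_prop (disch := assumption))]
    apply ae_restrict_of_ae
    filter_upwards [measure_eq_zero_iff_ae_notMem.1 hN] with r hr
    simp [hr]
  rw [h0, mul_zero, lintegral_eq_zero_iff (by fun_prop (disch := assumption))] at h
  filter_upwards [h] with x hx
  by_contra hc
  have : ‖x‖ ∈ N := subset_toMeasurable _ _ hc
  simp [this] at hx

end Polar

/-! ### Passage to `H¹` limits of test functions. -/

section Closure

/-- Hölder's inequality. It serves to extend weak identities from test functions to their `H¹`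
limits. -/
theorem tendsto_integral_bilin_of_eLpNorm {α E F G : Type*} [MeasurableSpace α] {μ : Measure α}
    [NormedAddCommGroup E] [NormedSpace ℝ E] [NormedAddCommGroup F] [NormedSpace ℝ F]
    [NormedAddCommGroup G] [NormedSpace ℝ G] (B : E →L[ℝ] F →L[ℝ] G) {f : α → E} {g : α → F}
    {u : ℕ → α → F} (hf : MemLp f 2 μ) (hg : MemLp g 2 μ) (hu : ∀ k, MemLp (u k) 2 μ)
    (h : Tendsto (fun k => eLpNorm (fun x => g x - u k x) 2 μ) atTop (𝓝 0)) :
    Tendsto (fun k => ∫ x, B (f x) (u k x) ∂μ) atTop (𝓝 (∫ x, B (f x) (g x) ∂μ)) := by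
  have hint : ∀ w : α → F, MemLp w 2 μ → Integrable (fun x => B (f x) (w x)) μ := fun w hw =>
    memLp_one_iff_integrable.1 (B.memLp_of_bilin 1 hf hw)
  refine tendsto_integral_of_L1' _ (hint g hg).aestronglyMeasurable
    (Eventually.of_forall fun k => hint _ (hu k)) ?_
  have hb : ∀ k, eLpNorm ((fun x => B (f x) (u k x)) - fun x => B (f x) (g x)) 1 μ ≤
      ‖B‖₊ * eLpNorm f 2 μ * eLpNorm (fun x => g x - u k x) 2 μ := by
    intro k
    have h1 : eLpNorm ((fun x => B (f x) (u k x)) - fun x => B (f x) (g x)) 1 μ =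
        eLpNorm (fun x => B (f x) (g x - u k x)) 1 μ := by
      rw [eLpNorm_sub_comm]
      congr 1
      ext x
      simp
    rw [h1]
    exact eLpNorm_le_eLpNorm_mul_eLpNorm_of_nnnorm hf.1 (hg.1.sub (hu k).1) (fun a b => B a b) ‖B‖₊
      (.of_forall fun _ ↦ B.le_opNorm₂ _ _)
  have hc : (‖B‖₊ : ℝ≥0∞) * eLpNorm f 2 μ ≠ ⊤ := ENNReal.mul_ne_top (by simp) hf.2.ne
  refine tendsto_of_tendsto_of_tendsto_of_le_of_le tendsto_const_nhds
    (h := fun k => ‖B‖₊ * eLpNorm f 2 μ * eLpNorm (fun x => g x - u k x) 2 μ) ?_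
    (fun _ => zero_le) hb
  simpa using ENNReal.Tendsto.const_mul h (Or.inr hc)

namespace IsTestFunctionOn

variable {Ω : Set Plane} {ψ η : Plane → ℝ}

theorem continuous_gradient (h : IsTestFunctionOn Ω ψ) : Continuous (gradient ψ) := by
  have h1 : Continuous (fderiv ℝ ψ) := h.contDiff.continuous_fderiv (by simp)
  exact (InnerProductSpace.toDual ℝ Plane).symm.continuous.comp h1

theorem gradient_eq_zero (h : IsTestFunctionOn Ω ψ) {x : Plane} (hx : x ∉ Ω) :
    gradient ψ x = 0 := by
  have h1 : fderiv ℝ ψ x = 0 := by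
    by_contra hc
    exact hx (h.tsupport_subset (support_fderiv_subset ℝ hc))
  simp [gradient, h1]

theorem eq_zero (h : IsTestFunctionOn Ω ψ) {x : Plane} (hx : x ∉ Ω) : ψ x = 0 := by
  by_contra hc
  exact hx (h.tsupport_subset (subset_tsupport _ hc))

theorem hasCompactSupport_gradient (h : IsTestFunctionOn Ω ψ) :
    HasCompactSupport (gradient ψ) := by
  have := h.hasCompactSupport.fderiv (𝕜 := ℝ)
  exact this.comp_left (g := (InnerProductSpace.toDual ℝ Plane).symm) (by simp)

theorem memLp (h : IsTestFunctionOn Ω ψ) (p : ℝ≥0∞) : MemLp ψ p (volume.restrict Ω) :=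
  (h.contDiff.continuous.memLp_of_hasCompactSupport h.hasCompactSupport).restrict Ω

theorem memLp_gradient (h : IsTestFunctionOn Ω ψ) (p : ℝ≥0∞) :
    MemLp (gradient ψ) p (volume.restrict Ω) :=
  (h.continuous_gradient.memLp_of_hasCompactSupport h.hasCompactSupport_gradient).restrict Ω

theorem differentiable (h : IsTestFunctionOn Ω ψ) : Differentiable ℝ ψ :=
  h.contDiff.differentiable (by simp)

theorem integral_add_const_smul_gradient (hψ : IsTestFunctionOn Ω ψ) (hη : IsTestFunctionOn Ω η)
    (c : ℝ) :
    ∫ x in Ω, (c + ψ x) • gradient η x = - ∫ x in Ω, η x • gradient ψ x := by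
  rw [setIntegral_eq_integral_of_forall_compl_eq_zero
      (fun x hx => by rw [hη.gradient_eq_zero hx, smul_zero]),
    setIntegral_eq_integral_of_forall_compl_eq_zero
      (fun x hx => by rw [hη.eq_zero hx, zero_smul])]
  have cs1 : HasCompactSupport fun x => (c + ψ x) • gradient η x :=
    hη.hasCompactSupport_gradient.smul_left (f := fun x => c + ψ x)
  have cs2 : HasCompactSupport fun x => η x • gradient ψ x :=
    hψ.hasCompactSupport_gradient.smul_left (f := η)
  have cψ := hψ.contDiff.continuous
  have cη := hη.contDiff.continuous
  have cgψ := hψ.continuous_gradient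
  have cgη := hη.continuous_gradient
  have i1 : Integrable fun x => (c + ψ x) • gradient η x :=
    Continuous.integrable_of_hasCompactSupport (by fun_prop) cs1
  have i2 : Integrable fun x => η x • gradient ψ x :=
    Continuous.integrable_of_hasCompactSupport (by fun_prop) cs2
  refine ext_inner_left ℝ fun e => ?_
  rw [inner_neg_right, ← integral_inner i1, ← integral_inner i2]
  have e1 : ∀ x, inner ℝ e ((c + ψ x) • gradient η x) = (c + ψ x) * fderiv ℝ η x e := by
    intro x; rw [inner_smul_right, inner_gradient_right]; simp
  have e2 : ∀ x, inner ℝ e (η x • gradient ψ x) =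
      fderiv ℝ (fun y => c + ψ y) x e * η x := by
    intro x; rw [inner_smul_right, inner_gradient_right, fderiv_const_add]; simp [mul_comm]
  simp_rw [e1, e2]
  apply integral_mul_fderiv_eq_neg_fderiv_mul_of_integrable
  · simp_rw [← e2]; exact i2.const_inner e
  · simp_rw [← e1]; exact i1.const_inner e
  · exact Continuous.integrable_of_hasCompactSupport (by fun_prop)
      (hη.hasCompactSupport.mul_left (f := fun x => c + ψ x))
  · intro x _; exact (hψ.differentiable x).const_add c
  · intro x _; exact hη.differentiable x

end IsTestFunctionOn

theorem memLp_of_tendsto_eLpNorm_sub {α E : Type*} [MeasurableSpace α] {μ : Measure α}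
    [NormedAddCommGroup E] {f : α → E} {u : ℕ → α → E} (hf : AEStronglyMeasurable f μ)
    (hu : ∀ k, MemLp (u k) 2 μ)
    (h : Tendsto (fun k => eLpNorm (fun x => f x - u k x) 2 μ) atTop (𝓝 0)) : MemLp f 2 μ := by
  obtain ⟨k, hk⟩ := (h.eventually_lt_const zero_lt_one).exists
  have h1 : MemLp (fun x => f x - u k x) 2 μ := ⟨hf.sub (hu k).1, hk.trans ENNReal.one_lt_top⟩
  convert h1.add (hu k) using 1
  ext x
  simp

/-- A limit of constants plus test functions, in the `H¹` norm, lies in `H¹`. -/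
theorem hasH1Gradient_of_tendsto {Ω : Set Plane} (hfin : volume Ω ≠ ⊤)
    {φ : Plane → ℝ} {g : Plane → Plane} {c : ℝ} {ψ : ℕ → Plane → ℝ}
    (hφ : AEStronglyMeasurable φ (volume.restrict Ω))
    (hg : AEStronglyMeasurable g (volume.restrict Ω))
    (hψ : ∀ k, IsTestFunctionOn Ω (ψ k))
    (h1 : Tendsto (fun k => eLpNorm (fun x => φ x - c - ψ k x) 2 (volume.restrict Ω))
      atTop (𝓝 0))
    (h2 : Tendsto (fun k => eLpNorm (fun x => g x - gradient (ψ k) x) 2 (volume.restrict Ω))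
      atTop (𝓝 0)) : HasH1Gradient Ω φ g := by
  have : IsFiniteMeasure (volume.restrict Ω) := ⟨by simpa using hfin.lt_top⟩
  have hu : ∀ k, MemLp (fun x => c + ψ k x) 2 (volume.restrict Ω) := fun k =>
    (memLp_const c).add ((hψ k).memLp 2)
  have h1' : Tendsto (fun k => eLpNorm (fun x => φ x - (c + ψ k x)) 2 (volume.restrict Ω))
      atTop (𝓝 0) := by simpa only [sub_sub] using h1
  have mφ := memLp_of_tendsto_eLpNorm_sub hφ hu h1'
  have mg := memLp_of_tendsto_eLpNorm_sub hg (fun k => (hψ k).memLp_gradient 2) h2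
  refine ⟨mφ, mg, fun η hη => ?_⟩
  have t1 := tendsto_integral_bilin_of_eLpNorm (ContinuousLinearMap.lsmul ℝ ℝ).flip
    (hη.memLp_gradient 2) mφ hu h1'
  have t2 := tendsto_integral_bilin_of_eLpNorm (ContinuousLinearMap.lsmul ℝ ℝ (E := Plane))
    (hη.memLp 2) mg (fun k => (hψ k).memLp_gradient 2) h2
  simp only [ContinuousLinearMap.flip_apply, ContinuousLinearMap.lsmul_apply] at t1 t2
  refine tendsto_nhds_unique t1 (t2.neg.congr fun k => ?_)
  exact ((hψ k).integral_add_const_smul_gradient hη c).symm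

end Closure

/-! ### Radial functions in `H¹` of a disc. -/

section RadialSobolev

theorem eLpNorm_two_sq {α E : Type*} [MeasurableSpace α] {μ : Measure α} [NormedAddCommGroup E]
    (f : α → E) : eLpNorm f 2 μ ^ 2 = ∫⁻ x, ‖f x‖ₑ ^ 2 ∂μ := by
  have := eLpNorm_nnreal_pow_eq_lintegral (f := f) (μ := μ) (p := 2) (by norm_num)
  simpa using this

theorem tendsto_eLpNorm_two_iff {α E : Type*} [MeasurableSpace α] {μ : Measure α}
    [NormedAddCommGroup E] (f : ℕ → α → E) :
    Tendsto (fun k => eLpNorm (f k) 2 μ) atTop (𝓝 0) ↔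
      Tendsto (fun k => ∫⁻ x, ‖f k x‖ₑ ^ 2 ∂μ) atTop (𝓝 0) := by
  simp_rw [← eLpNorm_two_sq]
  constructor
  · intro h
    simpa using ENNReal.Tendsto.pow (n := 2) h
  · intro h
    have := (ENNReal.continuous_rpow_const (y := (1 / 2 : ℝ))).tendsto 0 |>.comp h
    simp only [Function.comp_def, ENNReal.zero_rpow_of_pos (by norm_num : (0 : ℝ) < 1 / 2)] at this
    refine this.congr fun k => ?_
    rw [← ENNReal.rpow_natCast, ← ENNReal.rpow_mul]
    simp

/-- A smooth `L²` approximant `G` of the cut-off function is multiplied by a bump supported inside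
the interval. The bump is at most `1`, so it does not enlarge the error of `G`, and its own error
vanishes by dominated convergence as its plateau fills the interval. -/
theorem exists_smooth_approx_Ioo {p : ℝ → ℝ} (hp : Measurable p) {B : ℝ} (hB : ∀ t, |p t| ≤ B)
    {s ρ : ℝ} (hs : s < ρ) {ε : ℝ} (hε : 0 < ε) : ∃ P : ℝ → ℝ, ContDiff ℝ ∞ P ∧
      (∃ a b, s < a ∧ b < ρ ∧ ∀ t, t ∉ Icc a b → P t = 0) ∧
      eLpNorm (fun t => (Ioo s ρ).indicator p t - P t) 2 volume ≤ ENNReal.ofReal ε := by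
  set p1 := (Ioo s ρ).indicator p with hp1
  have mp1 : Measurable p1 := hp.indicator measurableSet_Ioo
  have hB0 : 0 ≤ B := (abs_nonneg _).trans (hB 0)
  have bp1 : ∀ t, ‖p1 t‖ ≤ B := fun t => by
    rw [hp1]; by_cases h : t ∈ Ioo s ρ <;> simp [h, hB, hB0]
  have hL : MemLp p1 2 volume := by
    rw [hp1, memLp_indicator_iff_restrict measurableSet_Ioo]
    exact MemLp.of_bound hp.aestronglyMeasurable B (.of_forall hB)
  set r := (ρ - s) / 2 with hr
  have hr0 : 0 < r := by rw [hr]; linarith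
  have hk : ∀ k : ℕ, 1 / ((k : ℝ) + 3) ≤ 1 / 3 ∧ 0 < 1 / ((k : ℝ) + 3) := fun k => by
    refine ⟨one_div_le_one_div_of_le (by norm_num) ?_, by positivity⟩
    linarith [k.cast_nonneg (α := ℝ)]
  -- Both radii increase to half the length `r` of the interval but stay below it; the shift by `3`
  -- keeps the inner radius positive for `k = 0`.
  let χ : ℕ → ContDiffBump ((s + ρ) / 2) := fun k =>
    { rIn := r * (1 - 2 * (1 / ((k : ℝ) + 3)))
      rOut := r * (1 - 1 / ((k : ℝ) + 3))
      rIn_pos := mul_pos hr0 (by linarith [hk k])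
      rIn_lt_rOut := mul_lt_mul_of_pos_left (by linarith [hk k]) hr0 }
  have hlim : Tendsto (fun k : ℕ => r * (1 - 2 * (1 / ((k : ℝ) + 3)))) atTop (𝓝 r) := by
    have h1 : Tendsto (fun k : ℕ => 1 / ((k : ℝ) + 3)) atTop (𝓝 0) := by
      have := (tendsto_const_div_atTop_nhds_zero_nat (1 : ℝ)).comp (tendsto_add_atTop_nat 3)
      refine this.congr fun k => ?_
      simp
    have := ((h1.const_mul 2).const_sub 1).const_mul r
    simpa using this
  have hconv : Tendsto (fun k => eLpNorm (fun t => p1 t - χ k t * p1 t) 2 volume)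
      atTop (𝓝 0) := by
    rw [tendsto_eLpNorm_two_iff]
    have := tendsto_lintegral_of_dominated_convergence (μ := volume)
      (F := fun k t => ‖p1 t - χ k t * p1 t‖ₑ ^ 2) (f := fun _ => 0) (fun t => ‖p1 t‖ₑ ^ 2)
      (fun k => ?_) (fun k => ?_) ?_ ?_
    · simpa using this
    · have := (χ k).continuous.measurable
      fun_prop
    · refine .of_forall fun t => ?_
      have h1 : p1 t - χ k t * p1 t = (1 - χ k t) * p1 t := by ring
      have h2 : ‖1 - χ k t‖ₑ ≤ 1 := by
        rw [Real.enorm_eq_ofReal (by linarith [(χ k).le_one (x := t)])]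
        exact ENNReal.ofReal_le_one.2 (by linarith [(χ k).nonneg (x := t)])
      change _ ^ 2 ≤ _ ^ 2
      rw [h1, enorm_mul]
      gcongr
      exact mul_le_of_le_one_left' h2
    · rw [← eLpNorm_two_sq]
      exact ENNReal.pow_ne_top hL.2.ne
    · refine .of_forall fun t => ?_
      by_cases ht : t ∈ Ioo s ρ
      · have h1 : |t - (s + ρ) / 2| < r := by
          rw [abs_lt, hr]; constructor <;> linarith [ht.1, ht.2]
        refine tendsto_const_nhds.congr' ?_
        filter_upwards [hlim.eventually_const_lt h1] with k hk
        have : χ k t = 1 := by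
          apply (χ k).one_of_mem_closedBall
          rw [Metric.mem_closedBall, Real.dist_eq]
          exact hk.le
        simp [this]
      · simp [hp1, ht]
  have hε2 : 0 < ε / 2 := by positivity
  obtain ⟨k, hkk⟩ := (hconv.eventually_le_const (ENNReal.ofReal_pos.2 hε2)).exists
  obtain ⟨G, hG1, hG2, hG3⟩ := hL.exist_eLpNorm_sub_le (by simp) (by simp) hε2
  refine ⟨fun t => χ k t * G t, (χ k).contDiff.mul hG2, ⟨(s + ρ) / 2 - (χ k).rOut,
    (s + ρ) / 2 + (χ k).rOut, ?_, ?_, ?_⟩, ?_⟩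
  · have : (χ k).rOut < r := by
      change r * _ < r
      nlinarith [hk k]
    linarith
  · have : (χ k).rOut < r := by
      change r * _ < r
      nlinarith [hk k]
    linarith
  · intro t ht
    have : χ k t = 0 := by
      apply (χ k).zero_of_le_dist
      rw [Real.dist_eq]
      by_contra hc
      push Not at hc
      rw [abs_lt] at hc
      exact ht ⟨by linarith [hc.1], by linarith [hc.2]⟩
    simp [this]
  · have mχ := (χ k).continuous.measurable
    have mG := hG2.continuous.measurable
    have h1 : (fun t => p1 t - χ k t * G t) =
        (fun t => p1 t - χ k t * p1 t) + fun t => χ k t * (p1 - G) t := by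
      ext t; simp; ring
    rw [h1]
    refine (eLpNorm_add_le (by fun_prop) (by fun_prop) (by simp)).trans ?_
    have h2 : eLpNorm (fun t => χ k t * (p1 - G) t) 2 volume ≤ eLpNorm (p1 - G) 2 volume := by
      refine eLpNorm_mono fun t => ?_
      rw [norm_mul]
      refine mul_le_of_le_one_left (norm_nonneg _) ?_
      rw [Real.norm_of_nonneg (χ k).nonneg]
      exact (χ k).le_one
    calc _ ≤ ENNReal.ofReal (ε / 2) + ENNReal.ofReal (ε / 2) := add_le_add hkk (h2.trans hG3)
      _ = _ := by rw [← ENNReal.ofReal_add hε2.le hε2.le, add_halves]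

theorem hasGradientAt_norm_comp {f : ℝ → ℝ} {f' : ℝ} {x : Plane} (hx : x ≠ 0)
    (hf : HasDerivAt f f' ‖x‖) : HasGradientAt (fun y : Plane => f ‖y‖) ((f' / ‖x‖) • x) x := by
  have hx' : ‖x‖ ≠ 0 := by simpa using hx
  have h1 : HasFDerivAt (fun y : Plane => ‖y‖) ((1 / ‖x‖) • innerSL ℝ x) x := by
    have h2 := ((hasStrictFDerivAt_norm_sq x).hasFDerivAt).sqrt (by positivity)
    simp only [Real.sqrt_sq (norm_nonneg _)] at h2
    have e : (1 / ‖x‖) • innerSL ℝ x = (1 / (2 * ‖x‖)) • (2 : ℕ) • innerSL ℝ x := by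
      ext y
      simp
      field_simp
    rw [e]
    exact h2
  rw [hasGradientAt_iff_hasFDerivAt]
  have e : (InnerProductSpace.toDual ℝ Plane) ((f' / ‖x‖) • x) =
      f' • (1 / ‖x‖) • (innerSL ℝ) x := by
    ext y
    simp [div_eq_mul_inv, mul_assoc]
  rw [e]
  exact hf.comp_hasFDerivAt x h1

/-- The norm is not smooth at the origin, but the function is constant there because the integrand
vanishes below `a`. -/
theorem contDiff_integral_norm {P : ℝ → ℝ} (hP : ContDiff ℝ ∞ P) {a ρ : ℝ} (ha : 0 < a)
    (h0 : ∀ t < a, P t = 0) : ContDiff ℝ ∞ (fun x : Plane => -∫ t in ‖x‖..ρ, P t) := by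
  have hF : ContDiff ℝ ∞ (fun r : ℝ => ∫ t in ρ..r, P t) := by
    rw [contDiff_infty_iff_deriv]
    have hd : ∀ r, HasDerivAt (fun r : ℝ => ∫ t in ρ..r, P t) (P r) r := fun r =>
      intervalIntegral.integral_hasDerivAt_right (hP.continuous.intervalIntegrable _ _)
        (hP.continuous.stronglyMeasurableAtFilter _ _) hP.continuous.continuousAt
    refine ⟨fun r => (hd r).differentiableAt, ?_⟩
    rwa [show deriv (fun r : ℝ => ∫ t in ρ..r, P t) = P from funext fun r => (hd r).deriv]
  simp_rw [← intervalIntegral.integral_symm]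
  rw [contDiff_iff_contDiffAt]
  intro x
  by_cases hx : x = 0
  · have : (fun x : Plane => ∫ t in ρ..‖x‖, P t) =ᶠ[𝓝 x] fun _ => ∫ t in ρ..0, P t := by
      subst hx
      filter_upwards [Metric.ball_mem_nhds (0 : Plane) ha] with y hy
      have hy' : ‖y‖ < a := by simpa using hy
      rw [← sub_eq_zero]
      rw [intervalIntegral.integral_interval_sub_left (hP.continuous.intervalIntegrable _ _)
        (hP.continuous.intervalIntegrable _ _)]
      rw [intervalIntegral.integral_congr (g := fun _ => 0), intervalIntegral.integral_zero]
      intro t ht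
      rw [uIcc_of_le (norm_nonneg y)] at ht
      exact h0 t (ht.2.trans_lt hy')
    exact contDiffAt_const.congr_of_eventuallyEq this
  · exact hF.contDiffAt.comp x (contDiffAt_norm ℝ hx)

/-- A radial function with bounded derivative that is constant near the origin lies in `H¹` of the
ball, with the expected gradient and boundary value. -/
theorem hasH1Gradient_radial {p : ℝ → ℝ} (hp : Measurable p) {B : ℝ} (hB : ∀ t, |p t| ≤ B)
    {s ρ : ℝ} (hs : 0 < s) (hsρ : s < ρ) (h0 : ∀ t ≤ s, p t = 0) (c : ℝ) :
    HasH1Gradient (Metric.ball 0 ρ) (fun x => c - ∫ t in ‖x‖..ρ, p t)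
      (fun x => (p ‖x‖ / ‖x‖) • x) ∧
    HasBoundaryValue (Metric.ball 0 ρ) (fun x => c - ∫ t in ‖x‖..ρ, p t)
      (fun x => (p ‖x‖ / ‖x‖) • x) c := by
  have hρ : 0 < ρ := hs.trans hsρ
  choose P hP1 hP2 hP3 using fun k : ℕ =>
    exists_smooth_approx_Ioo hp hB hsρ (Nat.one_div_pos_of_nat (α := ℝ) (n := k))
  choose a b ha hb hab using hP2
  set D : ℕ → ℝ → ℝ := fun k t => (Ioo s ρ).indicator p t - P k t with hD
  have hDt : Tendsto (fun k => eLpNorm (D k) 2 volume) atTop (𝓝 0) := by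
    refine tendsto_of_tendsto_of_tendsto_of_le_of_le tendsto_const_nhds ?_
      (fun _ => zero_le) hP3
    simpa using ENNReal.tendsto_ofReal (tendsto_one_div_add_atTop_nhds_zero_nat (𝕜 := ℝ))
  have hDp : ∀ k t, t < ρ → D k t = p t - P k t := by
    intro k t ht
    by_cases hts : s < t
    · simp [hD, hts, ht]
    · simp [hD, hts, h0 t (not_lt.1 hts)]
  have mD : ∀ k, Measurable (D k) := fun k =>
    (hp.indicator measurableSet_Ioo).sub (hP1 k).continuous.measurable
  -- Approximating the radial derivative rather than the function makes `ψ k` a genuine test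
  -- function: it is constant near the origin and zero near the boundary circle, since `P k` is
  -- supported in a compact part of `(s, ρ)`.
  set ψ : ℕ → Plane → ℝ := fun k x => -∫ t in ‖x‖..ρ, P k t with hψd
  have hψ : ∀ k, IsTestFunctionOn (Metric.ball 0 ρ) (ψ k) := by
    intro k
    have hsupp : tsupport (ψ k) ⊆ Metric.closedBall 0 (b k) := by
      refine closure_minimal ?_ Metric.isClosed_closedBall
      intro x hx
      by_contra hc
      have hc' : b k < ‖x‖ := by simpa using hc
      apply hx
      simp only [hψd]
      rw [intervalIntegral.integral_congr (g := fun _ => 0), intervalIntegral.integral_zero,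
        neg_zero]
      intro t ht
      refine hab k t fun h => ?_
      rcases le_total ‖x‖ ρ with h1 | h1
      · rw [uIcc_of_le h1] at ht
        linarith [ht.1, h.2]
      · rw [uIcc_of_ge h1] at ht
        linarith [ht.1, h.2, hb k]
    refine ⟨contDiff_integral_norm (hP1 k) hs fun t ht => hab k t fun h => ?_, ?_, ?_⟩
    · linarith [h.1, ha k]
    · exact HasCompactSupport.of_support_subset_isCompact (isCompact_closedBall 0 (b k))
        ((subset_tsupport _).trans hsupp)
    · exact hsupp.trans (Metric.closedBall_subset_ball (hb k))
  have hgrad : ∀ k (x : Plane), x ≠ 0 → gradient (ψ k) x = (P k ‖x‖ / ‖x‖) • x := by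
    intro k x hx
    refine (hasGradientAt_norm_comp (f := fun r => -∫ t in r..ρ, P k t) hx ?_).gradient
    have := (intervalIntegral.integral_hasDerivAt_left (b := ρ) (a := ‖x‖)
      ((hP1 k).continuous.intervalIntegrable _ _)
      ((hP1 k).continuous.stronglyMeasurableAtFilter _ _) (hP1 k).continuous.continuousAt).neg
    rw [neg_neg] at this
    exact this
  have ip : ∀ x y, IntervalIntegrable p volume x y := fun x y =>
    intervalIntegrable_const.mono_fun (f := fun _ => B) hp.aestronglyMeasurable
      (.of_forall fun t => (hB t).trans (le_abs_self B))
  have h1 : Tendsto (fun k => eLpNorm (fun x : Plane => (c - ∫ t in ‖x‖..ρ, p t) - c - ψ k x) 2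
      (volume.restrict (Metric.ball 0 ρ))) atTop (𝓝 0) := by
    -- By Cauchy–Schwarz in the radial variable, the values converge even uniformly.
    have hbd : ∀ k (x : Plane), x ∈ Metric.ball (0 : Plane) ρ →
        ‖(c - ∫ t in ‖x‖..ρ, p t) - c - ψ k x‖ₑ ≤
          eLpNorm (D k) 2 volume * ENNReal.ofReal ρ ^ (1 / 2 : ℝ) := by
      intro k x hx
      have hx' : ‖x‖ < ρ := by simpa using hx
      have e1 : (c - ∫ t in ‖x‖..ρ, p t) - c - ψ k x = -∫ t in Ioo ‖x‖ ρ, D k t := by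
        have : ∫ t in Ioo ‖x‖ ρ, D k t = ∫ t in ‖x‖..ρ, (p t - P k t) := by
          rw [intervalIntegral.integral_of_le hx'.le, integral_Ioc_eq_integral_Ioo]
          exact setIntegral_congr_fun measurableSet_Ioo fun t ht => hDp k t ht.2
        rw [this, intervalIntegral.integral_sub (ip _ _)
          ((hP1 k).continuous.intervalIntegrable _ _)]
        simp only [hψd]
        ring
      rw [e1, enorm_neg]
      calc ‖∫ t in Ioo ‖x‖ ρ, D k t‖ₑ ≤ ∫⁻ t in Ioo ‖x‖ ρ, ‖D k t‖ₑ :=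
            enorm_integral_le_lintegral_enorm _
        _ ≤ ∫⁻ t in Ioo 0 ρ, ‖D k t‖ₑ :=
            lintegral_mono_set (Ioo_subset_Ioo_left (norm_nonneg x))
        _ = eLpNorm (D k) 1 (volume.restrict (Ioo 0 ρ)) := eLpNorm_one_eq_lintegral_enorm.symm
        _ ≤ eLpNorm (D k) 2 (volume.restrict (Ioo 0 ρ)) * ENNReal.ofReal ρ ^ (1 / 2 : ℝ) := by
            have := eLpNorm_le_eLpNorm_mul_rpow_measure_univ (p := 1) (q := 2)
              (μ := volume.restrict (Ioo 0 ρ)) (by simp) (mD k).aestronglyMeasurable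
            refine this.trans_eq ?_
            congr 1
            norm_num
        _ ≤ _ := by
            gcongr
            exact Measure.restrict_le_self
    have hle : ∀ k, eLpNorm (fun x : Plane => (c - ∫ t in ‖x‖..ρ, p t) - c - ψ k x) 2
        (volume.restrict (Metric.ball 0 ρ)) ≤
        (eLpNorm (D k) 2 volume * ENNReal.ofReal ρ ^ (1 / 2 : ℝ)) *
          volume (Metric.ball (0 : Plane) ρ) ^ (1 / 2 : ℝ) := by
      intro k
      have := eLpNorm_le_of_ae_enorm_bound (p := 2)
        (μ := (volume : Measure Plane).restrict (Metric.ball 0 ρ))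
        ((ae_restrict_iff' measurableSet_ball).2 (.of_forall (hbd k)))
      refine this.trans_eq ?_
      simp [mul_comm]
    refine tendsto_of_tendsto_of_tendsto_of_le_of_le tendsto_const_nhds ?_
      (fun _ => zero_le) hle
    have c1 : ENNReal.ofReal ρ ^ (1 / 2 : ℝ) ≠ ⊤ := by finiteness
    have c2 : volume (Metric.ball (0 : Plane) ρ) ^ (1 / 2 : ℝ) ≠ ⊤ :=
      ENNReal.rpow_ne_top_of_nonneg (by norm_num) measure_ball_lt_top.ne
    simpa using ENNReal.Tendsto.mul_const (ENNReal.Tendsto.mul_const hDt (Or.inr c1)) (Or.inr c2)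
  have h2 : Tendsto (fun k => eLpNorm (fun x : Plane => (p ‖x‖ / ‖x‖) • x - gradient (ψ k) x) 2
      (volume.restrict (Metric.ball 0 ρ))) atTop (𝓝 0) := by
    rw [tendsto_eLpNorm_two_iff] at hDt ⊢
    -- The polar weight is at most `ρ`, so one-dimensional `L²` convergence of the derivatives
    -- suffices.
    have hle : ∀ k, ∫⁻ x in Metric.ball (0 : Plane) ρ,
        ‖(p ‖x‖ / ‖x‖) • x - gradient (ψ k) x‖ₑ ^ 2 ≤
        ENNReal.ofReal (2 * Real.pi) * ENNReal.ofReal ρ * ∫⁻ t, ‖D k t‖ₑ ^ 2 := by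
      intro k
      have mI : Measurable ((Iio ρ).indicator fun t => ‖D k t‖ₑ ^ 2) :=
        ((mD k).enorm.pow_const 2).indicator measurableSet_Iio
      calc _ ≤ ∫⁻ x : Plane, (Iio ρ).indicator (fun t => ‖D k t‖ₑ ^ 2) ‖x‖ := by
            rw [← lintegral_indicator measurableSet_ball]
            refine lintegral_mono_ae ?_
            have : ∀ᵐ x : Plane, x ≠ 0 :=
              (measure_eq_zero_iff_ae_notMem (s := {(0 : Plane)})).1 (by simp)
            filter_upwards [this] with x hx
            by_cases hxρ : ‖x‖ < ρ
            · have hn : ‖x‖ ≠ 0 := by simpa using hx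
              have : (p ‖x‖ / ‖x‖) • x - gradient (ψ k) x = (D k ‖x‖ / ‖x‖) • x := by
                rw [hgrad k x hx, hDp k _ hxρ, ← sub_smul, sub_div]
              have e2 : ‖(D k ‖x‖ / ‖x‖) • x‖ₑ = ‖D k ‖x‖‖ₑ := by
                rw [← ofReal_norm, ← ofReal_norm, norm_smul, norm_div, norm_norm,
                  div_mul_cancel₀ _ hn]
              simp only [mem_Iio, hxρ, indicator_of_mem, mem_ball_zero_iff]
              rw [this, e2]
            · simp [hxρ]
        _ = ENNReal.ofReal (2 * Real.pi) * ∫⁻ r in Ioi (0 : ℝ), ENNReal.ofReal r *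
              (Iio ρ).indicator (fun t => ‖D k t‖ₑ ^ 2) r := lintegral_plane_norm mI
        _ ≤ ENNReal.ofReal (2 * Real.pi) * ∫⁻ r, ENNReal.ofReal ρ * ‖D k r‖ₑ ^ 2 := by
            refine mul_le_mul' le_rfl ?_
            refine (setLIntegral_le_lintegral _ _).trans (lintegral_mono fun r => ?_)
            by_cases hr : r < ρ
            · simp only [mem_Iio, hr, indicator_of_mem]
              gcongr
            · simp [hr]
        _ = _ := by
            rw [lintegral_const_mul _ ((mD k).enorm.pow_const 2), mul_assoc]
    refine tendsto_of_tendsto_of_tendsto_of_le_of_le tendsto_const_nhds ?_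
      (fun _ => zero_le) hle
    simpa using ENNReal.Tendsto.const_mul hDt (Or.inr (by finiteness))
  have mφ : Measurable fun x : Plane => c - ∫ t in ‖x‖..ρ, p t := by
    have : Continuous fun r : ℝ => ∫ t in ρ..r, p t :=
      intervalIntegral.continuous_primitive ip ρ
    simp_rw [intervalIntegral.integral_symm ρ]
    exact (continuous_const.sub (this.comp continuous_norm).neg).measurable
  have mg : Measurable fun x : Plane => (p ‖x‖ / ‖x‖) • x := by fun_prop
  exact ⟨hasH1Gradient_of_tendsto measure_ball_lt_top.ne mφ.aestronglyMeasurable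
    mg.aestronglyMeasurable hψ h1 h2, ψ, hψ, h1, h2⟩

end RadialSobolev

/-! ### Solving the radial equation by monotone iteration. -/

section ScatteringODE

/-- `f ↦ 1 + ∫_s^t τ⁻¹ ∫_s^τ q f`, the integral operator of the radial equation
`(t u')' = q u`. -/
noncomputable def volterraMap (q : ℝ → ℝ) (s : ℝ) (f : ℝ → ℝ≥0∞) (t : ℝ) : ℝ≥0∞ :=
  1 + ∫⁻ τ in Ioc s t, ENNReal.ofReal (1 / τ) * ∫⁻ σ in Ioc s τ, ENNReal.ofReal (q σ) * f σ

variable {q : ℝ → ℝ} {s : ℝ}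

theorem measurable_lintegral_Ioc (g : ℝ → ℝ≥0∞) (s : ℝ) :
    Measurable fun t => ∫⁻ σ in Ioc s t, g σ :=
  Monotone.measurable fun _ _ h => lintegral_mono_set (Ioc_subset_Ioc_right h)

theorem monotone_volterraMap_apply (f : ℝ → ℝ≥0∞) : Monotone (volterraMap q s f) :=
  fun _ _ h => add_le_add le_rfl (lintegral_mono_set (Ioc_subset_Ioc_right h))

theorem monotone_volterraMap : Monotone (volterraMap q s) := by
  intro f g hfg t
  unfold volterraMap
  gcongr
  exact hfg _

theorem volterraMap_iSup (hq : Measurable q) {V : ℕ → ℝ → ℝ≥0∞} (hV : ∀ n, Measurable (V n))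
    (hm : Monotone V) (t : ℝ) :
    volterraMap q s (fun σ => ⨆ n, V n σ) t = ⨆ n, volterraMap q s (V n) t := by
  have h1 : ∀ τ, ∫⁻ σ in Ioc s τ, ENNReal.ofReal (q σ) * ⨆ n, V n σ =
      ⨆ n, ∫⁻ σ in Ioc s τ, ENNReal.ofReal (q σ) * V n σ := by
    intro τ
    simp_rw [ENNReal.mul_iSup]
    exact lintegral_iSup (fun n => hq.ennreal_ofReal.mul (hV n))
      fun n m h σ => mul_le_mul' le_rfl (hm h σ)
  unfold volterraMap
  simp_rw [h1, ENNReal.mul_iSup]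
  rw [lintegral_iSup, ENNReal.add_iSup]
  · intro n
    exact (measurable_const.div measurable_id).ennreal_ofReal.mul (measurable_lintegral_Ioc _ _)
  · intro n m h τ
    refine mul_le_mul' le_rfl (lintegral_mono fun σ => mul_le_mul' le_rfl (hm h σ))

theorem lintegral_Ioc_exp {κ : ℝ} (hκ : 0 < κ) {t : ℝ} (hst : s ≤ t) :
    ∫⁻ σ in Ioc s t, ENNReal.ofReal (Real.exp (κ * (σ - s))) =
      ENNReal.ofReal ((Real.exp (κ * (t - s)) - 1) / κ) := by
  rw [← ofReal_integral_eq_lintegral_ofReal, ← intervalIntegral.integral_of_le hst]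
  · congr 1
    have hd : ∀ x ∈ uIcc s t, HasDerivAt (fun x => Real.exp (κ * (x - s)) / κ)
        (Real.exp (κ * (x - s))) x := by
      intro x _
      have := ((((hasDerivAt_id x).sub_const s).const_mul κ).exp).div_const κ
      refine this.congr_deriv ?_
      field_simp
      simp
    rw [intervalIntegral.integral_eq_sub_of_hasDerivAt hd
      (Continuous.intervalIntegrable (by fun_prop) _ _)]
    simp [sub_div]
  · exact (Continuous.integrableOn_Ioc (by fun_prop))
  · exact .of_forall fun _ => (Real.exp_pos _).le

/-- The exponential is a supersolution: with `q ≤ B` and `1 / τ ≤ 1 / s`, the two integrations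
produce the factor `(B / s) / κ²`, where `κ = 1 + B / s`, and this is at most `1`. -/
theorem volterraMap_le_exp {B : ℝ} (hqB : ∀ t, q t ≤ B) (hB : 0 ≤ B)
    (hs : 0 < s) {f : ℝ → ℝ≥0∞}
    (hf : ∀ t, s ≤ t → f t ≤ ENNReal.ofReal (Real.exp ((1 + B / s) * (t - s)))) {t : ℝ}
    (hst : s ≤ t) :
    volterraMap q s f t ≤ ENNReal.ofReal (Real.exp ((1 + B / s) * (t - s))) := by
  set κ := 1 + B / s with hκ
  have hBs : 0 ≤ B / s := by positivity
  have hκ1 : 1 ≤ κ := by linarith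
  have hκ0 : 0 < κ := by linarith
  have inner : ∀ τ, s ≤ τ → ∫⁻ σ in Ioc s τ, ENNReal.ofReal (q σ) * f σ ≤
      ENNReal.ofReal (B / κ * Real.exp (κ * (τ - s))) := by
    intro τ hτ
    calc _ ≤ ∫⁻ σ in Ioc s τ, ENNReal.ofReal B * ENNReal.ofReal (Real.exp (κ * (σ - s))) := by
          refine setLIntegral_mono (by fun_prop) fun σ hσ => ?_
          exact mul_le_mul' (ENNReal.ofReal_le_ofReal (hqB σ)) (hf σ hσ.1.le)
      _ = ENNReal.ofReal (B * ((Real.exp (κ * (τ - s)) - 1) / κ)) := by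
          rw [lintegral_const_mul _ (by fun_prop), lintegral_Ioc_exp hκ0 hτ,
            ← ENNReal.ofReal_mul hB]
      _ ≤ _ := by
          apply ENNReal.ofReal_le_ofReal
          rw [← mul_div_assoc, div_mul_eq_mul_div]
          gcongr
          linarith
  have hexp : 1 ≤ Real.exp (κ * (t - s)) := by
    apply Real.one_le_exp
    exact mul_nonneg hκ0.le (by linarith)
  have outer : ∫⁻ τ in Ioc s t, ENNReal.ofReal (1 / τ) *
      ∫⁻ σ in Ioc s τ, ENNReal.ofReal (q σ) * f σ ≤
      ENNReal.ofReal (Real.exp (κ * (t - s)) - 1) := by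
    calc _ ≤ ∫⁻ τ in Ioc s t, ENNReal.ofReal (1 / s * (B / κ)) *
            ENNReal.ofReal (Real.exp (κ * (τ - s))) := by
          refine setLIntegral_mono (by fun_prop) fun τ hτ => ?_
          rw [ENNReal.ofReal_mul (by positivity), mul_assoc, ← ENNReal.ofReal_mul (by positivity)]
          refine mul_le_mul' (ENNReal.ofReal_le_ofReal ?_) (inner τ hτ.1.le)
          exact one_div_le_one_div_of_le hs hτ.1.le
      _ = ENNReal.ofReal (1 / s * (B / κ) * ((Real.exp (κ * (t - s)) - 1) / κ)) := by
          rw [lintegral_const_mul _ (by fun_prop), lintegral_Ioc_exp hκ0 hst,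
            ← ENNReal.ofReal_mul (by positivity)]
      _ ≤ _ := by
          apply ENNReal.ofReal_le_ofReal
          have h1 : 1 / s * (B / κ) * ((Real.exp (κ * (t - s)) - 1) / κ) =
              (B / s) / κ ^ 2 * (Real.exp (κ * (t - s)) - 1) := by field_simp
          rw [h1]
          apply mul_le_of_le_one_left (by linarith)
          rw [div_le_one (by positivity)]
          nlinarith
  calc volterraMap q s f t ≤ ENNReal.ofReal 1 + ENNReal.ofReal (Real.exp (κ * (t - s)) - 1) := by
        unfold volterraMap
        rw [ENNReal.ofReal_one]
        gcongr
    _ = _ := by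
        rw [← ENNReal.ofReal_add zero_le_one (by linarith)]
        congr 1
        ring

/-- Picard iteration from `0` is increasing, so in `[0, ∞]` it has a supremum, which is a fixed
point by monotone convergence. No contraction estimate is needed; the exponential supersolution
gives finiteness. -/
theorem exists_volterraMap_fixedPoint (hq : Measurable q) {B : ℝ} (hqB : ∀ t, q t ≤ B)
    (hB : 0 ≤ B) (hs : 0 < s) :
    ∃ U : ℝ → ℝ≥0∞, volterraMap q s U = U ∧ ∀ t, U t ≠ ⊤ := by
  let V : ℕ → ℝ → ℝ≥0∞ := fun n => (volterraMap q s)^[n] 0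
  have hVs : ∀ n, V (n + 1) = volterraMap q s (V n) := fun n =>
    Function.iterate_succ_apply' _ _ _
  have hm : Monotone V := Monotone.monotone_iterate_of_le_map monotone_volterraMap (fun _ => zero_le)
  have hV : ∀ n, Measurable (V n) := by
    intro n
    cases n with
    | zero => exact measurable_zero
    | succ n => rw [hVs]; exact (monotone_volterraMap_apply _).measurable
  have hb : ∀ n t, s ≤ t → V n t ≤ ENNReal.ofReal (Real.exp ((1 + B / s) * (t - s))) := by
    intro n
    induction n with
    | zero => intro t _; exact zero_le
    | succ n ih => intro t ht; rw [hVs]; exact volterraMap_le_exp hqB hB hs ih ht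
  have hfix : volterraMap q s (fun σ => ⨆ n, V n σ) = fun σ => ⨆ n, V n σ := by
    ext t
    rw [volterraMap_iSup hq hV hm]
    simp_rw [← hVs]
    exact Monotone.iSup_nat_add (f := fun n => V n t) (fun n m h => hm h t) 1
  refine ⟨_, hfix, fun t => ?_⟩
  rcases le_total s t with h | h
  · exact ((iSup_le fun n => hb n t h).trans_lt ENNReal.ofReal_lt_top).ne
  · change (fun σ => ⨆ n, V n σ) t ≠ ⊤
    rw [← hfix]
    simp [volterraMap, Ioc_eq_empty (not_lt.2 h)]

/-- `u` solves `(t u')' = q u`, with `u = 1` on `(-∞, s]`, and `h = t u'`. -/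
structure IsRadialSolution (q : ℝ → ℝ) (s : ℝ) (u h : ℝ → ℝ) : Prop where
  monotone : Monotone u
  eq_one : ∀ t ≤ s, u t = 1
  flux : ∀ t, h t = ∫ σ in s..t, q σ * u σ
  eq : ∀ t, u t = 1 + ∫ τ in s..t, h τ / τ

theorem exists_isRadialSolution (hq : Measurable q) (hq0 : ∀ t, 0 ≤ q t) {B : ℝ}
    (hqB : ∀ t, q t ≤ B) (hs : 0 < s) (hqs : ∀ t ≤ s, q t = 0) :
    ∃ u h, IsRadialSolution q s u h := by
  obtain ⟨U, hU, hUt⟩ := exists_volterraMap_fixedPoint hq hqB ((hq0 0).trans (hqB 0)) hs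
  have hUm : Monotone U := hU ▸ monotone_volterraMap_apply U
  set u : ℝ → ℝ := fun t => (U t).toReal with hu
  set h : ℝ → ℝ := fun t => ∫ σ in s..t, q σ * u σ with hh
  have hum : Monotone u := fun a b hab => ENNReal.toReal_mono (hUt b) (hUm hab)
  have hu1 : ∀ t ≤ s, u t = 1 := by
    intro t ht
    rw [hu]
    simp only
    rw [← hU]
    simp [volterraMap, Ioc_eq_empty (not_lt.2 ht)]
  have hofu : ∀ t, ENNReal.ofReal (u t) = U t := fun t => ENNReal.ofReal_toReal (hUt t)
  have hu0 : ∀ t, 0 ≤ u t := fun t => ENNReal.toReal_nonneg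
  have hh0 : ∀ t ≤ s, h t = 0 := by
    intro t ht
    rw [hh]
    simp only
    rw [intervalIntegral.integral_congr (g := fun _ => 0), intervalIntegral.integral_zero]
    intro σ hσ
    rw [uIcc_of_ge ht] at hσ
    simp [hqs σ hσ.2]
  have hhn : ∀ t, 0 ≤ h t := by
    intro t
    rcases le_total s t with ht | ht
    · exact intervalIntegral.integral_nonneg ht fun σ _ => mul_nonneg (hq0 σ) (hu0 σ)
    · rw [hh0 t ht]
  have iqu : ∀ a b, IntervalIntegrable (fun σ => q σ * u σ) volume a b := by
    intro a b
    refine (hum.intervalIntegrable.const_mul B).mono_fun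
      (hq.mul hum.measurable).aestronglyMeasurable (.of_forall fun t => ?_)
    simp only
    rw [Real.norm_of_nonneg (mul_nonneg (hq0 t) (hu0 t)),
      Real.norm_of_nonneg (mul_nonneg ((hq0 0).trans (hqB 0)) (hu0 t))]
    exact mul_le_mul_of_nonneg_right (hqB t) (hu0 t)
  have hofh : ∀ τ, s ≤ τ → ENNReal.ofReal (h τ) = ∫⁻ σ in Ioc s τ, ENNReal.ofReal (q σ) * U σ := by
    intro τ hτ
    simp only [hh]
    rw [intervalIntegral.integral_of_le hτ, ofReal_integral_eq_lintegral_ofReal]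
    · refine lintegral_congr fun σ => ?_
      rw [ENNReal.ofReal_mul (hq0 σ), hofu]
    · exact (iqu s τ).1
    · exact .of_forall fun σ => mul_nonneg (hq0 σ) (hu0 σ)
  have hmeas : Measurable h := by
    have : Continuous h := intervalIntegral.continuous_primitive iqu s
    exact this.measurable
  refine ⟨u, h, hum, hu1, fun t => rfl, fun t => ?_⟩
  rcases le_total s t with ht | ht
  · rw [intervalIntegral.integral_of_le ht, integral_eq_lintegral_of_nonneg_ae]
    · have e1 : u t = (volterraMap q s U t).toReal := by rw [hU]
      have e2 : ∫⁻ τ in Ioc s t, ENNReal.ofReal (1 / τ) *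
          ∫⁻ σ in Ioc s τ, ENNReal.ofReal (q σ) * U σ =
          ∫⁻ τ in Ioc s t, ENNReal.ofReal (h τ / τ) := by
        refine setLIntegral_congr_fun measurableSet_Ioc fun τ hτ => ?_
        have : 0 < τ := hs.trans hτ.1
        rw [← hofh τ hτ.1.le, ← ENNReal.ofReal_mul (by positivity)]
        congr 1
        ring
      rw [e1]
      have e3 : volterraMap q s U t ≠ ⊤ := by rw [hU]; exact hUt t
      unfold volterraMap at e3 ⊢
      rw [e2] at e3 ⊢
      rw [ENNReal.toReal_add (by simp) (ne_top_of_le_ne_top e3 le_add_self)]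
      simp
    · exact (ae_restrict_iff' measurableSet_Ioc).2 (.of_forall fun τ hτ =>
        div_nonneg (hhn τ) (hs.trans hτ.1).le)
    · exact (hmeas.div measurable_id).aestronglyMeasurable
  · rw [hu1 t ht, intervalIntegral.integral_congr (g := fun _ => 0),
      intervalIntegral.integral_zero, add_zero]
    intro τ hτ
    rw [uIcc_of_ge ht] at hτ
    simp [hh0 τ hτ.2]

end ScatteringODE

/-! ### Flux, growth and weak form of the radial solution. -/

section RadialSolution

theorem isFiniteMeasure_restrict_ball (ρ : ℝ) :
    IsFiniteMeasure ((volume : Measure Plane).restrict (Metric.ball 0 ρ)) :=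
  ⟨by rw [Measure.restrict_apply_univ]; exact measure_ball_lt_top⟩

/-- `q` is bounded, measurable, nonnegative and vanishes outside of `(s, r)`. -/
structure IsAnnularCoeff (q : ℝ → ℝ) (s r : ℝ) : Prop where
  measurable : Measurable q
  nonneg : ∀ t, 0 ≤ q t
  bounded : ∃ B, ∀ t, q t ≤ B
  pos : 0 < s
  nonneg_outer : 0 ≤ r
  zero_of_le : ∀ t ≤ s, q t = 0
  zero_of_ge : ∀ t, r ≤ t → q t = 0

namespace IsRadialSolution

variable {q u h : ℝ → ℝ} {s r : ℝ}

theorem one_le (hu : IsRadialSolution q s u h) (t : ℝ) : 1 ≤ u t := by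
  rcases le_total t s with ht | ht
  · exact (hu.eq_one t ht).ge
  · exact (hu.eq_one s le_rfl).ge.trans (hu.monotone ht)

theorem pos (hu : IsRadialSolution q s u h) (t : ℝ) : 0 < u t :=
  zero_lt_one.trans_le (hu.one_le t)

variable (hq : IsAnnularCoeff q s r) (hu : IsRadialSolution q s u h)
include hq hu

theorem exists_bound_mul : ∃ B, ∀ t, |q t * u t| ≤ B := by
  obtain ⟨B, hB⟩ := hq.bounded
  refine ⟨B * u r, fun t => ?_⟩
  have h0 : 0 ≤ B := (hq.nonneg 0).trans (hB 0)
  rw [abs_of_nonneg (mul_nonneg (hq.nonneg t) (hu.pos t).le)]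
  rcases le_total r t with ht | ht
  · rw [hq.zero_of_ge t ht, zero_mul]
    exact mul_nonneg h0 (hu.pos r).le
  · exact mul_le_mul (hB t) (hu.monotone ht) (hu.pos t).le h0

theorem intervalIntegrable_mul (a b : ℝ) :
    IntervalIntegrable (fun σ => q σ * u σ) volume a b := by
  obtain ⟨B, hB⟩ := hu.exists_bound_mul hq
  exact intervalIntegrable_const.mono_fun (f := fun _ => B)
    (hq.measurable.mul hu.monotone.measurable).aestronglyMeasurable
    (.of_forall fun t => (hB t).trans (le_abs_self B))

theorem flux_sub (a b : ℝ) : h b - h a = ∫ σ in a..b, q σ * u σ := by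
  rw [hu.flux, hu.flux, intervalIntegral.integral_interval_sub_left] <;>
  exact hu.intervalIntegrable_mul hq _ _

theorem continuous_flux : Continuous h := by
  have : h = fun t => ∫ σ in s..t, q σ * u σ := funext hu.flux
  rw [this]
  exact intervalIntegral.continuous_primitive (hu.intervalIntegrable_mul hq) s

theorem monotone_flux : Monotone h := by
  intro a b hab
  rw [← sub_nonneg, hu.flux_sub hq]
  exact intervalIntegral.integral_nonneg hab fun σ _ => mul_nonneg (hq.nonneg σ) (hu.pos σ).le

theorem flux_eq_zero {t : ℝ} (ht : t ≤ s) : h t = 0 := by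
  rw [hu.flux, intervalIntegral.integral_congr (g := fun _ => 0), intervalIntegral.integral_zero]
  intro σ hσ
  rw [uIcc_of_ge ht] at hσ
  simp [hq.zero_of_le σ hσ.2]

theorem flux_nonneg (t : ℝ) : 0 ≤ h t := by
  rcases le_total t s with ht | ht
  · rw [hu.flux_eq_zero hq ht]
  · rw [← hu.flux_eq_zero hq le_rfl]
    exact hu.monotone_flux hq ht

theorem flux_eq {t : ℝ} (ht : r ≤ t) : h t = h r := by
  rw [← sub_eq_zero, hu.flux_sub hq, intervalIntegral.integral_congr (g := fun _ => 0),
    intervalIntegral.integral_zero]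
  intro σ hσ
  rw [uIcc_of_le ht] at hσ
  simp [hq.zero_of_ge σ hσ.1]

theorem flux_le (t : ℝ) : h t ≤ h r := by
  rcases le_total t r with ht | ht
  · exact hu.monotone_flux hq ht
  · exact (hu.flux_eq hq ht).le

theorem flux_eq_integral (t : ℝ) : h t = ∫ σ in (0)..t, q σ * u σ := by
  rw [← hu.flux_sub hq, hu.flux_eq_zero hq hq.pos.le, sub_zero]

theorem flux_div_nonneg (t : ℝ) : 0 ≤ h t / t := by
  rcases le_total t s with ht | ht
  · simp [hu.flux_eq_zero hq ht]
  · exact div_nonneg (hu.flux_nonneg hq t) (hq.pos.trans_le ht).le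

theorem flux_div_le (t : ℝ) : h t / t ≤ h r / s := by
  rcases le_total t s with ht | ht
  · rw [hu.flux_eq_zero hq ht, zero_div]
    exact div_nonneg (hu.flux_nonneg hq r) hq.pos.le
  · exact div_le_div₀ (hu.flux_nonneg hq r) (hu.flux_le hq t) hq.pos ht

theorem measurable_flux_div : Measurable fun t => h t / t :=
  (hu.continuous_flux hq).measurable.div measurable_id

theorem intervalIntegrable_flux_div (a b : ℝ) :
    IntervalIntegrable (fun t => h t / t) volume a b :=
  intervalIntegrable_const.mono_fun (f := fun _ => h r / s)
    (hu.measurable_flux_div hq).aestronglyMeasurable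
    (.of_forall fun t => by
      simp only
      rw [Real.norm_of_nonneg (hu.flux_div_nonneg hq t)]
      exact (hu.flux_div_le hq t).trans (le_abs_self _))

theorem sub_eq (a b : ℝ) : u b - u a = ∫ τ in a..b, h τ / τ := by
  rw [hu.eq a, hu.eq b, add_sub_add_left_eq_sub, intervalIntegral.integral_interval_sub_left] <;>
  exact hu.intervalIntegrable_flux_div hq _ _

theorem sub_eq_log {a b H : ℝ} (ha : 0 < a) (hb : 0 < b) (hH : ∀ t ∈ uIcc a b, h t = H) :
    u b - u a = H * Real.log (b / a) := by
  rw [hu.sub_eq hq, intervalIntegral.integral_congr (g := fun t => H * t⁻¹),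
    intervalIntegral.integral_const_mul, integral_inv_of_pos ha hb]
  intro t ht
  simp [hH t ht, div_eq_mul_inv]

/-- The flux `t u'` never exceeds its final value `h r`. This controls the growth of `u` across the
thin shell and across annuli. -/
theorem sub_le_log {a b : ℝ} (ha : 0 < a) (hab : a ≤ b) :
    u b - u a ≤ h r * Real.log (b / a) := by
  rw [hu.sub_eq hq, ← integral_inv_of_pos ha (ha.trans_le hab),
    ← intervalIntegral.integral_const_mul]
  refine intervalIntegral.integral_mono_on hab (hu.intervalIntegrable_flux_div hq _ _)
    ((intervalIntegral.intervalIntegrable_inv (fun t ht => ?_) continuousOn_id).const_mul _)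
    fun t ht => ?_
  · rw [uIcc_of_le hab] at ht
    exact (ha.trans_le ht.1).ne'
  · rw [div_eq_mul_inv]
    exact mul_le_mul_of_nonneg_right (hu.flux_le hq t) (inv_nonneg.2 (ha.le.trans ht.1))

/-- The flux is `∫ q u` and `u ≥ 1`. This is how the mass of a potential bounds its flux from below.
-/
theorem integral_le_flux : ∫ t in (0)..r, q t ≤ h r := by
  rw [hu.flux_eq_integral hq]
  obtain ⟨B, hB⟩ := hq.bounded
  refine intervalIntegral.integral_mono_on hq.nonneg_outer ?_ (hu.intervalIntegrable_mul hq _ _)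
    fun t _ => le_mul_of_one_le_right (hq.nonneg t) (hu.one_le t)
  refine intervalIntegrable_const.mono_fun (f := fun _ => B)
    hq.measurable.aestronglyMeasurable (.of_forall fun t => ?_)
  simp only
  rw [Real.norm_of_nonneg (hq.nonneg t)]
  exact (hB t).trans (le_abs_self _)

/-- Integration by parts. As `q` is merely bounded and measurable, `h` is only absolutely
continuous. The boundary terms vanish because `h 0 = 0` and `χ ρ = 0`. -/
theorem integral_flux_mul_deriv {χ : ℝ → ℝ} (hχ : ContDiff ℝ 1 χ) {ρ : ℝ}
    (hχρ : χ ρ = 0) :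
    ∫ t in (0)..ρ, h t * deriv χ t = -∫ t in (0)..ρ, q t * u t * χ t := by
  have hh : h = fun t => ∫ σ in (0)..t, q σ * u σ := funext (hu.flux_eq_integral hq)
  have hac : AbsolutelyContinuousOnInterval h 0 ρ := by
    rw [hh]
    exact (hu.intervalIntegrable_mul hq 0 ρ).absolutelyContinuousOnInterval_intervalIntegral
      (by simp)
  rw [hac.integral_mul_deriv_eq_deriv_mul hχ.contDiffOn.absolutelyContinuousOnInterval, hχρ,
    hu.flux_eq_zero hq hq.pos.le]
  simp only [mul_zero, zero_mul, sub_zero, zero_sub, neg_inj]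
  refine intervalIntegral.integral_congr_ae ?_
  filter_upwards [(hu.intervalIntegrable_mul hq 0 ρ).ae_hasDerivAt_integral] with t ht htm
  have := ht (uIoc_subset_uIcc htm) 0 (by simp)
  rw [← hh] at this
  rw [this.deriv]

omit hq hu in
theorem norm_div_smul_self_le (c : ℝ) (x : Plane) : ‖(c / ‖x‖) • x‖ ≤ |c| := by
  rw [norm_smul, norm_div, norm_norm, Real.norm_eq_abs]
  rcases eq_or_ne ‖x‖ 0 with hx | hx
  · simp [hx]
  · rw [div_mul_cancel₀ _ hx]

theorem exists_bound_mul_div : ∃ B, ∀ t, |q t / t * u t| ≤ B := by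
  obtain ⟨B, hB⟩ := hu.exists_bound_mul hq
  refine ⟨B / s, fun t => ?_⟩
  have h0 : 0 ≤ B := (abs_nonneg _).trans (hB 0)
  rcases le_total t s with ht | ht
  · rw [hq.zero_of_le t ht]
    simp only [zero_div, zero_mul, abs_zero]
    exact div_nonneg h0 hq.pos.le
  · rw [div_mul_eq_mul_div, abs_div, abs_of_pos (hq.pos.trans_le ht)]
    exact div_le_div₀ h0 (hB t) hq.pos ht

theorem measurable_mul_div : Measurable fun t => q t / t * u t :=
  (hq.measurable.div measurable_id).mul hu.monotone.measurable

/-- The weak form of `Δu = |x|⁻¹ q u`, tested with smooth functions. -/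
theorem integral_inner_gradient {ρ : ℝ} (hρ : 0 < ρ) {ψ : Plane → ℝ}
    (hψ : IsTestFunctionOn (Metric.ball 0 ρ) ψ) :
    ∫ x in Metric.ball (0 : Plane) ρ, inner ℝ ((h ‖x‖ / ‖x‖ / ‖x‖) • x) (gradient ψ x) =
      -∫ x in Metric.ball (0 : Plane) ρ, q ‖x‖ / ‖x‖ * u ‖x‖ * ψ x := by
  rw [setIntegral_eq_integral_of_forall_compl_eq_zero
      (fun x hx => by rw [hψ.gradient_eq_zero hx, inner_zero_right]),
    setIntegral_eq_integral_of_forall_compl_eq_zero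
      (fun x hx => by rw [hψ.eq_zero hx, mul_zero])]
  have m1 := hu.measurable_flux_div hq
  have m2 := hu.measurable_mul_div hq
  have i1 : Integrable fun x : Plane =>
      inner ℝ ((h ‖x‖ / ‖x‖ / ‖x‖) • x) (gradient ψ x) := by
    have ig := (hψ.continuous_gradient.integrable_of_hasCompactSupport
      hψ.hasCompactSupport_gradient (μ := volume)).norm.const_mul (h r / s)
    have m3 : Measurable fun x : Plane => h ‖x‖ / ‖x‖ := m1.comp measurable_norm
    have mg : Measurable (gradient ψ) := hψ.continuous_gradient.measurable
    refine ig.mono' (by fun_prop) (.of_forall fun x => ?_)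
    refine (norm_inner_le_norm _ _).trans
      (mul_le_mul_of_nonneg_right ((norm_div_smul_self_le _ _).trans ?_) (norm_nonneg _))
    rw [abs_of_nonneg (hu.flux_div_nonneg hq _)]
    exact hu.flux_div_le hq _
  have i2 : Integrable fun x : Plane => q ‖x‖ / ‖x‖ * u ‖x‖ * ψ x := by
    obtain ⟨B, hB⟩ := hu.exists_bound_mul_div hq
    have ig := (hψ.contDiff.continuous.integrable_of_hasCompactSupport
      hψ.hasCompactSupport (μ := volume)).norm.const_mul B
    have m3 : Measurable fun x : Plane => q ‖x‖ / ‖x‖ * u ‖x‖ := m2.comp measurable_norm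
    have mψ : Measurable ψ := hψ.contDiff.continuous.measurable
    refine ig.mono' (m3.mul mψ).aestronglyMeasurable (.of_forall fun x => ?_)
    rw [norm_mul]
    exact mul_le_mul_of_nonneg_right (hB _) (norm_nonneg _)
  -- On each ray the polar weight `t` cancels one factor `1 / t`, and the identity becomes the
  -- one-dimensional integration by parts.
  rw [integral_plane_polar i1, integral_plane_polar i2, ← integral_neg]
  congr 1 with θ
  have hθ : ‖(θ : Plane)‖ = 1 := by simp
  set χ : ℝ → ℝ := fun t => ψ (t • (θ : Plane)) with hχ
  have hχs : ContDiff ℝ 1 χ := by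
    have : ContDiff ℝ 1 ψ := hψ.contDiff.of_le (by simp)
    exact this.comp (contDiff_id.smul contDiff_const)
  have hmem : ∀ t, ρ ≤ t → t • (θ : Plane) ∉ Metric.ball (0 : Plane) ρ := by
    intro t ht
    simp [norm_smul, hθ, abs_of_nonneg (hρ.le.trans ht), ht]
  have hd : ∀ t, deriv χ t = inner ℝ (θ : Plane) (gradient ψ (t • (θ : Plane))) := by
    intro t
    have h1 : HasDerivAt (fun t : ℝ => t • (θ : Plane)) (θ : Plane) t := by
      simpa using (hasDerivAt_id t).smul_const (θ : Plane)
    have h2 := ((hψ.differentiable (t • (θ : Plane))).hasFDerivAt).comp_hasDerivAt t h1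
    rw [inner_gradient_right]
    exact h2.deriv
  have hc : ∀ f : ℝ → ℝ, (∀ t, ρ ≤ t → f t = 0) → ∫ t in Ioi (0 : ℝ), f t = ∫ t in (0)..ρ, f t := by
    intro f hf
    rw [intervalIntegral.integral_of_le hρ.le]
    refine setIntegral_eq_of_subset_of_forall_sdiff_eq_zero measurableSet_Ioi Ioc_subset_Ioi_self
      fun t ht => hf t ?_
    by_contra hc
    exact ht.2 ⟨ht.1, (not_le.1 hc).le⟩
  have e1 : ∫ t in Ioi (0 : ℝ), t * inner ℝ ((h ‖t • (θ : Plane)‖ / ‖t • (θ : Plane)‖ /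
      ‖t • (θ : Plane)‖) • t • (θ : Plane)) (gradient ψ (t • (θ : Plane))) =
      ∫ t in Ioi (0 : ℝ), h t * deriv χ t := by
    refine setIntegral_congr_fun measurableSet_Ioi fun t ht => ?_
    have ht' : 0 < t := ht
    simp only [norm_smul, hθ, Real.norm_of_nonneg ht'.le, mul_one, hd, smul_smul,
      real_inner_smul_left]
    field_simp
  have e2 : ∫ t in Ioi (0 : ℝ), t * (q ‖t • (θ : Plane)‖ / ‖t • (θ : Plane)‖ *
      u ‖t • (θ : Plane)‖ * ψ (t • (θ : Plane))) = ∫ t in Ioi (0 : ℝ), q t * u t * χ t := by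
    refine setIntegral_congr_fun measurableSet_Ioi fun t ht => ?_
    have ht' : 0 < t := ht
    simp only [norm_smul, hθ, Real.norm_of_nonneg ht'.le, mul_one, hχ]
    field_simp
  rw [e1, e2, hc _ fun t ht => ?_, hc _ fun t ht => ?_,
    hu.integral_flux_mul_deriv hq hχs (hψ.eq_zero (hmem ρ le_rfl))]
  · rw [hχ]
    simp only
    rw [hψ.eq_zero (hmem t ht), mul_zero]
  · rw [hd, hψ.gradient_eq_zero (hmem t ht), inner_zero_right, mul_zero]

theorem memLp_flux_smul (ρ : ℝ) : MemLp (fun x : Plane => (h ‖x‖ / ‖x‖ / ‖x‖) • x) 2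
    (volume.restrict (Metric.ball 0 ρ)) := by
  have : IsFiniteMeasure ((volume : Measure Plane).restrict (Metric.ball 0 ρ)) :=
    isFiniteMeasure_restrict_ball ρ
  have m3 : Measurable fun x : Plane => h ‖x‖ / ‖x‖ :=
    (hu.measurable_flux_div hq).comp measurable_norm
  refine MemLp.of_bound (by fun_prop) (h r / s) (.of_forall fun x => ?_)
  refine (norm_div_smul_self_le _ _).trans ?_
  rw [abs_of_nonneg (hu.flux_div_nonneg hq _)]
  exact hu.flux_div_le hq _

theorem memLp_mul_div (ρ : ℝ) : MemLp (fun x : Plane => q ‖x‖ / ‖x‖ * u ‖x‖) 2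
    (volume.restrict (Metric.ball 0 ρ)) := by
  have : IsFiniteMeasure ((volume : Measure Plane).restrict (Metric.ball 0 ρ)) :=
    isFiniteMeasure_restrict_ball ρ
  obtain ⟨B, hB⟩ := hu.exists_bound_mul_div hq
  have m3 : Measurable fun x : Plane => q ‖x‖ / ‖x‖ * u ‖x‖ :=
    (hu.measurable_mul_div hq).comp measurable_norm
  exact MemLp.of_bound m3.aestronglyMeasurable B (.of_forall fun x => hB _)

/-- The weak form of `Δu = |x|⁻¹ q u`, tested with an `H¹` function that is constant on the
boundary of the ball. -/
theorem integral_weak {ρ : ℝ} (hρ : 0 < ρ) (hr : r ≤ ρ) {φ : Plane → ℝ} {g : Plane → Plane} {k : ℝ}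
    (hφ : HasH1Gradient (Metric.ball 0 ρ) φ g) (hb : HasBoundaryValue (Metric.ball 0 ρ) φ g k) :
    (∫ x in Metric.ball (0 : Plane) ρ, inner ℝ ((h ‖x‖ / ‖x‖ / ‖x‖) • x) (g x)) +
      ∫ x in Metric.ball (0 : Plane) ρ, q ‖x‖ / ‖x‖ * u ‖x‖ * φ x = k * (2 * Real.pi * h r) := by
  have : IsFiniteMeasure ((volume : Measure Plane).restrict (Metric.ball 0 ρ)) :=
    isFiniteMeasure_restrict_ball ρ
  obtain ⟨ψ, hψ, h1, h2⟩ := hb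
  have mF := hu.memLp_flux_smul hq ρ
  have mQ := hu.memLp_mul_div hq ρ
  have t1 : Tendsto (fun k => ∫ x in Metric.ball (0 : Plane) ρ,
      inner ℝ ((h ‖x‖ / ‖x‖ / ‖x‖) • x) (gradient (ψ k) x)) atTop
      (𝓝 (∫ x in Metric.ball (0 : Plane) ρ, inner ℝ ((h ‖x‖ / ‖x‖ / ‖x‖) • x) (g x))) :=
    tendsto_integral_bilin_of_eLpNorm (innerSL ℝ (E := Plane)) mF hφ.memLp_grad
    (fun k => (hψ k).memLp_gradient 2) h2
  have t2 := tendsto_integral_bilin_of_eLpNorm (ContinuousLinearMap.mul ℝ ℝ) mQ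
    (hφ.memLp.sub (memLp_const k)) (fun k => (hψ k).memLp 2) h1
  -- For each test function the two integrals cancel, so the weak equation holds for the limit `φ -
  -- k`. The constant `k` then contributes `k ∫ q u / |x|`, which is `k` times the total flux `2π h
  -- r`.
  have t3 := t1.add t2
  simp only [ContinuousLinearMap.mul_apply'] at t3
  have t4 := tendsto_nhds_unique t3 (tendsto_const_nhds.congr fun k => by
    rw [hu.integral_inner_gradient hq hρ (hψ k), neg_add_cancel])
  have i1 : Integrable (fun x : Plane => q ‖x‖ / ‖x‖ * u ‖x‖ * φ x)
      (volume.restrict (Metric.ball 0 ρ)) := mQ.integrable_mul hφ.memLp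
  have i2 : Integrable (fun x : Plane => q ‖x‖ / ‖x‖ * u ‖x‖ * k)
      (volume.restrict (Metric.ball 0 ρ)) := (mQ.integrable (by simp)).mul_const k
  have e1 : ∫ x in Metric.ball (0 : Plane) ρ, q ‖x‖ / ‖x‖ * u ‖x‖ =
      2 * Real.pi * h r := by
    rw [integral_ball_norm (fun t => q t / t * u t), ← hu.flux_eq hq hr, hu.flux_eq_integral hq,
      intervalIntegral.integral_of_le hρ.le, integral_Ioc_eq_integral_Ioo]
    congr 1
    refine setIntegral_congr_fun measurableSet_Ioo fun t ht => ?_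
    have : 0 < t := ht.1
    field_simp
  have e2 : ∫ x in Metric.ball (0 : Plane) ρ,
      q ‖x‖ / ‖x‖ * u ‖x‖ * (φ - (fun _ => k : Plane → ℝ)) x =
      (∫ x in Metric.ball (0 : Plane) ρ, q ‖x‖ / ‖x‖ * u ‖x‖ * φ x) - k * (2 * Real.pi * h r) := by
    rw [← e1, mul_comm k, ← integral_mul_const, ← integral_sub i1 i2]
    congr 1 with x
    simp only [Pi.sub_apply]
    ring
  rw [e2] at t4
  linarith

end IsRadialSolution
end RadialSolution

/-! ### Energy and scattering length of an annular potential. -/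

section AnnularPotential

/-- The function `u(max(|x|, r₀)) - c`, normalized to be `1` for `|x| = ρ`. -/
noncomputable def cutSolution (u : ℝ → ℝ) (r₀ c ρ t : ℝ) : ℝ := (u (max t r₀) - c) / (u ρ - c)

/-- The derivative of `cutSolution`. -/
noncomputable def cutSolutionDeriv (u h : ℝ → ℝ) (r₀ c ρ t : ℝ) : ℝ :=
  (Ioi r₀).indicator (fun t => h t / t) t / (u ρ - c)

namespace IsRadialSolution

variable {q u h : ℝ → ℝ} {s r : ℝ}
variable (hq : IsAnnularCoeff q s r) (hu : IsRadialSolution q s u h)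
include hq hu

theorem measurable_cutSolutionDeriv (r₀ c ρ : ℝ) : Measurable (cutSolutionDeriv u h r₀ c ρ) :=
  ((hu.measurable_flux_div hq).indicator measurableSet_Ioi).div_const _

theorem cutSolutionDeriv_bound {r₀ c ρ : ℝ} (hc : c < u ρ) (t : ℝ) :
    |cutSolutionDeriv u h r₀ c ρ t| ≤ h r / s / (u ρ - c) := by
  have h0 : 0 < u ρ - c := sub_pos.2 hc
  rw [cutSolutionDeriv, abs_div, abs_of_pos h0]
  gcongr
  have := div_nonneg (hu.flux_nonneg hq r) hq.pos.le
  by_cases ht : t ∈ Ioi r₀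
  · rw [indicator_of_mem ht, abs_of_nonneg (hu.flux_div_nonneg hq _)]
    exact hu.flux_div_le hq _
  · rw [indicator_of_notMem ht, abs_zero]
    exact this

theorem cutSolutionDeriv_eq_zero {r₀ c ρ t : ℝ} (ht : t ≤ s) :
    cutSolutionDeriv u h r₀ c ρ t = 0 := by
  rw [cutSolutionDeriv]
  by_cases h1 : t ∈ Ioi r₀
  · rw [indicator_of_mem h1, hu.flux_eq_zero hq ht, zero_div, zero_div]
  · rw [indicator_of_notMem h1, zero_div]

/-- This is the form in which `hasH1Gradient_radial` applies to the cut solution. -/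
theorem cutSolution_eq {r₀ c ρ t : ℝ} (hr₀ : r₀ ≤ ρ) (hc : c < u ρ) (ht : t ≤ ρ) :
    cutSolution u r₀ c ρ t = 1 - ∫ τ in t..ρ, cutSolutionDeriv u h r₀ c ρ τ := by
  have h0 : u ρ - c ≠ 0 := (sub_pos.2 hc).ne'
  have e : ∫ τ in t..ρ, (Ioi r₀).indicator (fun t => h t / t) τ = u ρ - u (max t r₀) := by
    rw [hu.sub_eq hq, intervalIntegral.integral_of_le ht,
      intervalIntegral.integral_of_le (max_le ht hr₀), setIntegral_indicator measurableSet_Ioi]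
    congr 2
    ext τ
    simp only [mem_inter_iff, mem_Ioc, mem_Ioi, max_lt_iff]
    tauto
  unfold cutSolutionDeriv
  rw [intervalIntegral.integral_div, e, cutSolution]
  field_simp
  ring

omit hq in
theorem cutSolution_nonneg {r₀ c ρ : ℝ} (hc : c < u ρ) (hc0 : c ≤ u r₀) (t : ℝ) :
    0 ≤ cutSolution u r₀ c ρ t :=
  div_nonneg (sub_nonneg.2 (hc0.trans (hu.monotone (le_max_right _ _)))) (sub_pos.2 hc).le

omit hq in
theorem cutSolution_le_one {r₀ c ρ t : ℝ} (hr₀ : r₀ ≤ ρ) (hc : c < u ρ) (ht : t ≤ ρ) :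
    cutSolution u r₀ c ρ t ≤ 1 := by
  rw [cutSolution, div_le_one (sub_pos.2 hc)]
  exact sub_le_sub_right (hu.monotone (max_le ht hr₀)) c

theorem hasH1Gradient_cutSolution {r₀ c ρ : ℝ} (hρ : 0 < ρ) (hc : c < u ρ) :
    HasH1Gradient (Metric.ball 0 ρ) (fun x => 1 - ∫ t in ‖x‖..ρ, cutSolutionDeriv u h r₀ c ρ t)
      (fun x => (cutSolutionDeriv u h r₀ c ρ ‖x‖ / ‖x‖) • x) ∧
    HasBoundaryValue (Metric.ball 0 ρ) (fun x => 1 - ∫ t in ‖x‖..ρ, cutSolutionDeriv u h r₀ c ρ t)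
      (fun x => (cutSolutionDeriv u h r₀ c ρ ‖x‖ / ‖x‖) • x) 1 :=
  hasH1Gradient_radial (hu.measurable_cutSolutionDeriv hq r₀ c ρ)
    -- The derivative vanishes up to `s`, but `s` need not be smaller than `ρ`.
    (hu.cutSolutionDeriv_bound hq hc) (s := min s (ρ / 2)) (lt_min hq.pos (half_pos hρ))
    ((min_le_right _ _).trans_lt (half_lt_self hρ))
    (fun _ ht => hu.cutSolutionDeriv_eq_zero hq (ht.trans (min_le_left _ _))) 1

omit hu in
theorem exists_bound_div : ∃ B, 0 ≤ B ∧ ∀ t, |q t / t| ≤ B := by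
  obtain ⟨B, hB⟩ := hq.bounded
  have h0 : 0 ≤ B := (hq.nonneg 0).trans (hB 0)
  refine ⟨B / s, div_nonneg h0 hq.pos.le, fun t => ?_⟩
  rcases le_total t s with ht | ht
  · rw [hq.zero_of_le t ht]
    simp only [zero_div, abs_zero]
    exact div_nonneg h0 hq.pos.le
  · rw [abs_div, abs_of_pos (hq.pos.trans_le ht), abs_of_nonneg (hq.nonneg t)]
    exact div_le_div₀ h0 (hB t) hq.pos ht

omit hu in
theorem div_nonneg_coeff (t : ℝ) : 0 ≤ q t / t := by
  rcases le_total t s with ht | ht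
  · simp [hq.zero_of_le t ht]
  · exact div_nonneg (hq.nonneg t) (hq.pos.le.trans ht)

omit hu in
theorem integrable_energy {Ω : Set Plane} {φ : Plane → ℝ} {g : Plane → Plane}
    (hφ : MemLp φ 2 (volume.restrict Ω)) (hg : MemLp g 2 (volume.restrict Ω)) :
    Integrable (fun x => ‖g x‖ ^ 2 + q ‖x‖ / ‖x‖ * φ x ^ 2) (volume.restrict Ω) := by
  obtain ⟨B, -, hB⟩ := exists_bound_div hq
  have m : Measurable fun x : Plane => q ‖x‖ / ‖x‖ :=
    (hq.measurable.comp measurable_norm).div measurable_norm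
  refine (hg.integrable_norm_pow (by simp)).add ?_
  exact hφ.integrable_sq.bdd_mul m.aestronglyMeasurable (.of_forall fun x => hB _)

omit hu in
theorem lintegral_energy_eq {Ω : Set Plane} {φ : Plane → ℝ} {g : Plane → Plane}
    {w : Plane → ℝ≥0∞} (hw : ∀ x, (1 / 2) * w x = ENNReal.ofReal (q ‖x‖ / ‖x‖))
    (hφ : MemLp φ 2 (volume.restrict Ω)) (hg : MemLp g 2 (volume.restrict Ω)) :
    ∫⁻ x in Ω, (‖g x‖ₑ ^ 2 + (1 / 2) * w x * ‖φ x‖ₑ ^ 2) =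
      ENNReal.ofReal (∫ x in Ω, (‖g x‖ ^ 2 + q ‖x‖ / ‖x‖ * φ x ^ 2)) := by
  have hn : ∀ x : Plane, 0 ≤ q ‖x‖ / ‖x‖ := fun x => div_nonneg_coeff hq _
  rw [ofReal_integral_eq_lintegral_ofReal (integrable_energy hq hφ hg)
    (.of_forall fun x => add_nonneg (sq_nonneg _) (mul_nonneg (hn x) (sq_nonneg _)))]
  refine lintegral_congr fun x => ?_
  rw [hw, ENNReal.ofReal_add (sq_nonneg _) (mul_nonneg (hn x) (sq_nonneg _)),
    ENNReal.ofReal_mul (hn x), ENNReal.ofReal_pow (norm_nonneg _), ofReal_norm,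
    ← sq_abs (φ x), ENNReal.ofReal_pow (abs_nonneg _), ← Real.norm_eq_abs, ofReal_norm]

/-- The energy of the cut solution, with respect to the potential that it solves. -/
theorem integral_energy_cutSolution_le {r₀ c ρ : ℝ} (hρ : 0 < ρ) (hrρ : r ≤ ρ) (hr₀ : r₀ ≤ ρ)
    (hc : c < u ρ) (hc0 : 0 ≤ c) (h0 : r₀ = 0 ∧ c = 0 ∨ c = u r₀) :
    ∫ x in Metric.ball (0 : Plane) ρ, (‖(cutSolutionDeriv u h r₀ c ρ ‖x‖ / ‖x‖) • x‖ ^ 2 +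
      q ‖x‖ / ‖x‖ * (1 - ∫ t in ‖x‖..ρ, cutSolutionDeriv u h r₀ c ρ t) ^ 2) ≤
      2 * Real.pi * h r / (u ρ - c) := by
  have hD : 0 < u ρ - c := sub_pos.2 hc
  obtain ⟨H, Hb⟩ := hu.hasH1Gradient_cutSolution hq hρ hc
  have key := hu.integral_weak hq hρ hrρ H Hb
  have i1 : Integrable (fun x : Plane => inner ℝ ((h ‖x‖ / ‖x‖ / ‖x‖) • x)
      ((cutSolutionDeriv u h r₀ c ρ ‖x‖ / ‖x‖) • x)) (volume.restrict (Metric.ball 0 ρ)) :=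
    memLp_one_iff_integrable.1
      ((innerSL ℝ (E := Plane)).memLp_of_bilin 1 (hu.memLp_flux_smul hq ρ) H.memLp_grad)
  have i2 : Integrable (fun x : Plane => q ‖x‖ / ‖x‖ * u ‖x‖ *
      (1 - ∫ t in ‖x‖..ρ, cutSolutionDeriv u h r₀ c ρ t)) (volume.restrict (Metric.ball 0 ρ)) :=
    (hu.memLp_mul_div hq ρ).integrable_mul H.memLp
  -- The weak equation is tested with the cut solution `φ` itself. After multiplication by `u ρ - c`
  -- the gradient terms agree, since `∇u = (u ρ - c) ∇φ` wherever `∇φ ≠ 0`; for the potential terms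
  -- `(u ρ - c) φ ≤ u` is enough.
  rw [← integral_add i1 i2, one_mul] at key
  rw [le_div_iff₀ hD, ← key, ← integral_mul_const]
  refine setIntegral_mono_on ((integrable_energy hq H.memLp H.memLp_grad).mul_const _)
    (i1.add i2) measurableSet_ball fun x hx => ?_
  have hx' : ‖x‖ < ρ := by simpa using hx
  rw [← hu.cutSolution_eq hq hr₀ hc hx'.le]
  have e1 : inner ℝ ((h ‖x‖ / ‖x‖ / ‖x‖) • x) ((cutSolutionDeriv u h r₀ c ρ ‖x‖ / ‖x‖) • x) =
      ‖(cutSolutionDeriv u h r₀ c ρ ‖x‖ / ‖x‖) • x‖ ^ 2 * (u ρ - c) := by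
    rw [cutSolutionDeriv]
    by_cases h1 : ‖x‖ ∈ Ioi r₀
    · rw [indicator_of_mem h1, real_inner_smul_left, real_inner_smul_right,
        real_inner_self_eq_norm_sq, norm_smul, mul_pow, Real.norm_eq_abs, sq_abs]
      field_simp
    · simp [indicator_of_notMem h1]
  rw [e1, add_mul]
  refine add_le_add le_rfl ?_
  rw [mul_assoc, mul_assoc]
  refine mul_le_mul_of_nonneg_left ?_ (div_nonneg_coeff hq _)
  have hφ0 : 0 ≤ cutSolution u r₀ c ρ ‖x‖ := by
    refine hu.cutSolution_nonneg hc ?_ _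
    rcases h0 with ⟨-, h0⟩ | h0
    · rw [h0]; exact (hu.pos r₀).le
    · exact h0.le
  have e2 : cutSolution u r₀ c ρ ‖x‖ * (u ρ - c) ≤ u ‖x‖ := by
    rw [cutSolution, div_mul_cancel₀ _ hD.ne']
    rcases le_total r₀ ‖x‖ with h1 | h1
    · rw [max_eq_left h1]; linarith
    · rw [max_eq_right h1]
      rcases h0 with ⟨h2, h3⟩ | h0
      · rw [h3, sub_zero]
        exact hu.monotone (h2 ▸ norm_nonneg x)
      · rw [h0, sub_self]
        exact (hu.pos _).le
  nlinarith

/-- Replacing `w` by `v` costs at most half the mass of `v - w` where the cut solution is nonzero,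
since `0 ≤ φ ≤ 1`. Inside `r₀` the cut solution vanishes and `v` costs nothing there, even where it
is infinite. If `r₀ = 0`, the region left out is a single point. -/
theorem lintegral_energy_cutSolution_le {r₀ c ρ : ℝ} (hρ : 0 < ρ) (hrρ : r ≤ ρ) (hr₀ : r₀ ≤ ρ)
    (hc : c < u ρ) (hc0 : 0 ≤ c) (h0 : r₀ = 0 ∧ c = 0 ∨ c = u r₀) {v w : Plane → ℝ≥0∞}
    (mw : Measurable w) (hw : ∀ x, (1 / 2) * w x = ENNReal.ofReal (q ‖x‖ / ‖x‖)) :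
    ∫⁻ x in Metric.ball (0 : Plane) ρ, (‖(cutSolutionDeriv u h r₀ c ρ ‖x‖ / ‖x‖) • x‖ₑ ^ 2 +
      (1 / 2) * v x * ‖1 - ∫ t in ‖x‖..ρ, cutSolutionDeriv u h r₀ c ρ t‖ₑ ^ 2) ≤
      ENNReal.ofReal (2 * Real.pi * h r / (u ρ - c)) +
        (1 / 2) * ∫⁻ x in {x : Plane | r₀ < ‖x‖ ∧ ‖x‖ < ρ}, (v x - w x) := by
  obtain ⟨H, Hb⟩ := hu.hasH1Gradient_cutSolution hq (r₀ := r₀) hρ hc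
  have mS : MeasurableSet {x : Plane | r₀ < ‖x‖} := measurableSet_lt measurable_const measurable_norm
  calc _ ≤ ∫⁻ x in Metric.ball (0 : Plane) ρ,
        ((‖(cutSolutionDeriv u h r₀ c ρ ‖x‖ / ‖x‖) • x‖ₑ ^ 2 +
        (1 / 2) * w x * ‖1 - ∫ t in ‖x‖..ρ, cutSolutionDeriv u h r₀ c ρ t‖ₑ ^ 2) +
        {x : Plane | r₀ < ‖x‖}.indicator (fun x => (1 / 2) * (v x - w x)) x) := by
        refine setLIntegral_mono_ae' measurableSet_ball ?_
        have hne : ∀ᵐ x : Plane, x ≠ 0 :=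
          (measure_eq_zero_iff_ae_notMem (s := {(0 : Plane)})).1 (by simp)
        filter_upwards [hne] with x hx0 hx
        have hx' : ‖x‖ < ρ := by simpa using hx
        rw [← hu.cutSolution_eq hq hr₀ hc hx'.le]
        by_cases h1 : r₀ < ‖x‖
        · rw [indicator_of_mem (show x ∈ {x : Plane | r₀ < ‖x‖} from h1), add_assoc]
          refine add_le_add le_rfl ?_
          have h2 : ‖cutSolution u r₀ c ρ ‖x‖‖ₑ ^ 2 ≤ 1 := by
            have h3 : 0 ≤ cutSolution u r₀ c ρ ‖x‖ := by
              refine hu.cutSolution_nonneg hc ?_ _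
              rcases h0 with ⟨-, h0⟩ | h0
              · rw [h0]; exact (hu.pos r₀).le
              · exact h0.le
            rw [Real.enorm_eq_ofReal h3]
            refine pow_le_one₀ zero_le (ENNReal.ofReal_le_one.2 ?_)
            exact hu.cutSolution_le_one hr₀ hc hx'.le
          calc (1 / 2) * v x * ‖cutSolution u r₀ c ρ ‖x‖‖ₑ ^ 2
              ≤ (1 / 2) * (w x + (v x - w x)) * ‖cutSolution u r₀ c ρ ‖x‖‖ₑ ^ 2 := by
                gcongr
                exact le_add_tsub
            _ = (1 / 2) * w x * ‖cutSolution u r₀ c ρ ‖x‖‖ₑ ^ 2 +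
                (1 / 2) * (v x - w x) * ‖cutSolution u r₀ c ρ ‖x‖‖ₑ ^ 2 := by ring
            _ ≤ _ := add_le_add le_rfl (mul_le_of_le_one_right' h2)
        · have h2 : cutSolution u r₀ c ρ ‖x‖ = 0 := by
            rw [cutSolution, max_eq_right (not_lt.1 h1)]
            rcases h0 with ⟨h3, -⟩ | h0
            · exact absurd (h3 ▸ norm_pos_iff.2 hx0) h1
            · rw [h0, sub_self, zero_div]
          simp [h2]
    _ = ENNReal.ofReal (∫ x in Metric.ball (0 : Plane) ρ,
        (‖(cutSolutionDeriv u h r₀ c ρ ‖x‖ / ‖x‖) • x‖ ^ 2 +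
        q ‖x‖ / ‖x‖ * (1 - ∫ t in ‖x‖..ρ, cutSolutionDeriv u h r₀ c ρ t) ^ 2)) +
        (1 / 2) * ∫⁻ x in {x : Plane | r₀ < ‖x‖ ∧ ‖x‖ < ρ}, (v x - w x) := by
        have hm : AEMeasurable (fun x : Plane => ‖(cutSolutionDeriv u h r₀ c ρ ‖x‖ / ‖x‖) • x‖ₑ ^ 2 +
            (1 / 2) * w x * ‖1 - ∫ t in ‖x‖..ρ, cutSolutionDeriv u h r₀ c ρ t‖ₑ ^ 2)
            (volume.restrict (Metric.ball 0 ρ)) :=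
          (H.memLp_grad.1.enorm.pow_const 2).add
            ((mw.const_mul _).aemeasurable.mul (H.memLp.1.enorm.pow_const 2))
        rw [lintegral_add_left' hm,
          lintegral_energy_eq hq hw H.memLp H.memLp_grad, setLIntegral_indicator mS,
          lintegral_const_mul' _ _ (by simp)]
        congr 4
        ext x
        simp
    _ ≤ _ := add_le_add (ENNReal.ofReal_le_ofReal
        (hu.integral_energy_cutSolution_le hq hρ hrρ hr₀ hc hc0 h0)) le_rfl

/-- The minimal energy of an annular potential. -/
theorem scatteringEnergy_eq {w : Plane → ℝ≥0∞}
    (hw : ∀ x, (1 / 2) * w x = ENNReal.ofReal (q ‖x‖ / ‖x‖)) {ρ : ℝ} (hρ : 0 < ρ) (hrρ : r ≤ ρ) :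
    scatteringEnergy w ρ = ENNReal.ofReal (2 * Real.pi * h r / u ρ) := by
  have hc : (0 : ℝ) < u ρ := hu.pos ρ
  have hE := hu.integral_energy_cutSolution_le hq hρ hrρ hρ.le hc le_rfl (Or.inl ⟨rfl, rfl⟩)
  obtain ⟨H, Hb⟩ := hu.hasH1Gradient_cutSolution hq (r₀ := 0) hρ hc
  rw [sub_zero] at hE
  apply le_antisymm
  · refine (iInf₂_le _ _).trans ((iInf₂_le H Hb).trans ?_)
    rw [lintegral_energy_eq hq hw H.memLp H.memLp_grad]
    exact ENNReal.ofReal_le_ofReal hE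
  · refine le_iInf₂ fun φ g => le_iInf₂ fun hφ hb => ?_
    rw [lintegral_energy_eq hq hw hφ.memLp hφ.memLp_grad]
    apply ENNReal.ofReal_le_ofReal
    have key := hu.integral_weak hq hρ hrρ hφ hb
    have i1 : Integrable (fun x : Plane => inner ℝ ((h ‖x‖ / ‖x‖ / ‖x‖) • x) (g x))
        (volume.restrict (Metric.ball 0 ρ)) :=
      memLp_one_iff_integrable.1
        ((innerSL ℝ (E := Plane)).memLp_of_bilin 1 (hu.memLp_flux_smul hq ρ) hφ.memLp_grad)
    have i2 : Integrable (fun x : Plane => q ‖x‖ / ‖x‖ * u ‖x‖ * φ x)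
        (volume.restrict (Metric.ball 0 ρ)) := (hu.memLp_mul_div hq ρ).integrable_mul hφ.memLp
    have i3 := integrable_energy hq H.memLp H.memLp_grad
    rw [← integral_add i1 i2, one_mul] at key
    have i4 : Integrable (fun x : Plane => 2 / u ρ * (inner ℝ ((h ‖x‖ / ‖x‖ / ‖x‖) • x) (g x) +
        q ‖x‖ / ‖x‖ * u ‖x‖ * φ x)) (volume.restrict (Metric.ball 0 ρ)) :=
      (i1.add i2).const_mul _
    -- The lower bound is convexity: with `φ₀ = u / u ρ`, the energy density of any competitor `φ`
    -- is at least twice its cross term with `φ₀` minus the density of `φ₀`. The cross term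
    -- integrates to `2π h r / u ρ` by the weak equation.
    have hle : 2 * Real.pi * h r / u ρ ≤ ∫ x in Metric.ball (0 : Plane) ρ,
        (2 / u ρ * (inner ℝ ((h ‖x‖ / ‖x‖ / ‖x‖) • x) (g x) + q ‖x‖ / ‖x‖ * u ‖x‖ * φ x) -
        (‖(cutSolutionDeriv u h 0 0 ρ ‖x‖ / ‖x‖) • x‖ ^ 2 +
          q ‖x‖ / ‖x‖ * (1 - ∫ t in ‖x‖..ρ, cutSolutionDeriv u h 0 0 ρ t) ^ 2)) := by
      rw [integral_sub i4 i3, integral_const_mul, key]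
      have : 2 / u ρ * (2 * Real.pi * h r) = 2 * (2 * Real.pi * h r / u ρ) := by ring
      linarith
    refine hle.trans (setIntegral_mono_on (i4.sub i3)
      (integrable_energy hq hφ.memLp hφ.memLp_grad) measurableSet_ball fun x hx => ?_)
    have hx' : ‖x‖ < ρ := by simpa using hx
    rw [← hu.cutSolution_eq hq hρ.le hc hx'.le]
    have e1 : (cutSolutionDeriv u h 0 0 ρ ‖x‖ / ‖x‖) • x =
        (1 / u ρ) • (h ‖x‖ / ‖x‖ / ‖x‖) • x := by
      rw [cutSolutionDeriv, smul_smul]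
      by_cases h1 : ‖x‖ ∈ Ioi 0
      · rw [indicator_of_mem h1]
        congr 1
        rw [sub_zero]
        ring
      · have : x = 0 := by simpa using h1
        simp [this]
    have e2 : cutSolution u 0 0 ρ ‖x‖ = 1 / u ρ * u ‖x‖ := by
      rw [cutSolution, max_eq_left (norm_nonneg x)]
      ring
    rw [e1, e2]
    set F := (h ‖x‖ / ‖x‖ / ‖x‖) • x with hF
    have hκ := div_nonneg_coeff hq ‖x‖
    set κ := q ‖x‖ / ‖x‖
    have n1 := norm_sub_sq_real (g x) ((1 / u ρ) • F)
    rw [real_inner_smul_right, real_inner_comm] at n1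
    have n2 : 0 ≤ κ * (φ x - 1 / u ρ * u ‖x‖) ^ 2 := by positivity
    have n3 := sq_nonneg ‖g x - (1 / u ρ) • F‖
    have n4 : 2 / u ρ * (inner ℝ F (g x) + κ * u ‖x‖ * φ x) =
      2 * (1 / u ρ * inner ℝ F (g x)) + 2 * κ * (1 / u ρ * u ‖x‖) * φ x := by ring
    rw [n4]
    nlinarith

/-- The solution of the radial equation determines the scattering length. -/
theorem exists_scatteringLength {w : Plane → ℝ≥0∞}
    (hw : ∀ x, (1 / 2) * w x = ENNReal.ofReal (q ‖x‖ / ‖x‖)) :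
    ∃ a', HasCompactScatteringLength w a' ∧
      ∀ ρ, 0 < ρ → r ≤ ρ → Real.log (ρ / a') = u ρ / h r := by
  classical
  set r₁ := max r 1 with hr₁
  have hr₁0 : 0 < r₁ := lt_of_lt_of_le one_pos (le_max_right _ _)
  -- This solves `log (r₁ / a') = u r₁ / h r`; `r₁` is used instead of `r`, which may be `0`. For `h
  -- r = 0` the choice `a' = 0` fits because both `log (ρ / 0)` and `u ρ / 0` are `0`.
  set a' : ℝ := if h r = 0 then 0 else r₁ * Real.exp (-(u r₁ / h r)) with ha'
  -- The scattering length has to be correct for every radius `r'` beyond which `w` vanishes,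
  -- including those below `r`.
  have hflux : ∀ r', 0 ≤ r' → VanishesBeyond w r' → IsAnnularCoeff q s r' := by
    intro r' h0 hV
    refine ⟨hq.measurable, hq.nonneg, hq.bounded, hq.pos, h0, hq.zero_of_le, fun t ht => ?_⟩
    have ht0 : 0 ≤ t := h0.trans ht
    have hx : ‖EuclideanSpace.single (0 : Fin 2) t‖ = t := by simp [abs_of_nonneg ht0]
    have h1 := hw (EuclideanSpace.single (0 : Fin 2) t)
    rw [hx, hV _ (by rw [hx]; exact ht), mul_zero, eq_comm, ENNReal.ofReal_eq_zero] at h1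
    rcases le_or_gt t s with hts | hts
    · exact hq.zero_of_le t hts
    · have htp := hq.pos.trans hts
      have : q t / t = 0 := le_antisymm h1 (div_nonneg_coeff hq t)
      rcases div_eq_zero_iff.1 this with h2 | h2
      · exact h2
      · exact absurd h2 htp.ne'
  have hlog : ∀ r', IsAnnularCoeff q s r' → ∀ ρ, 0 < ρ → r' ≤ ρ → h r ≠ 0 →
      h r * Real.log (ρ / a') = u ρ := by
    intro r' hq' ρ hρ hrρ hne
    have hfl : ∀ t, r' ≤ t → h t = h r := by
      intro t ht
      rw [hu.flux_eq hq' ht]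
      rcases le_total r r' with h1 | h1
      · exact hu.flux_eq hq h1
      · exact (hu.flux_eq hq' h1).symm
    rw [ha', if_neg hne]
    have hs : u ρ - u r₁ = h r * Real.log (ρ / r₁) := by
      rcases le_total ρ r₁ with h1 | h1
      · refine hu.sub_eq_log hq hr₁0 hρ fun t ht => hfl t ?_
        rw [uIcc_of_ge h1] at ht
        exact hrρ.trans ht.1
      · refine hu.sub_eq_log hq hr₁0 hρ fun t ht => hu.flux_eq hq ?_
        rw [uIcc_of_le h1] at ht
        exact (le_max_left _ _).trans ht.1
    have e : ρ / (r₁ * Real.exp (-(u r₁ / h r))) = ρ / r₁ * Real.exp (u r₁ / h r) := by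
      rw [Real.exp_neg]
      field_simp
    rw [e, Real.log_mul (by positivity) (Real.exp_pos _).ne', Real.log_exp, mul_add, ← hs]
    field_simp
    ring
  have hpos : h r ≠ 0 → 0 < a' := fun hne => by
    rw [ha', if_neg hne]
    positivity
  refine ⟨a', ⟨⟨r, hq.nonneg_outer, fun x hx => ?_⟩, ?_, fun r' ρ h0 hV hρ => ?_,
    fun r' ρ h0 hV hρ => ?_⟩, fun ρ hρ hrρ => ?_⟩
  · have := hw x
    rw [hq.zero_of_ge _ hx, zero_div, ENNReal.ofReal_zero] at this
    simpa using this
  · by_cases hne : h r = 0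
    · rw [ha', if_pos hne]
    · exact (hpos hne).le
  · have hρ0 := h0.trans_lt hρ
    by_cases hne : h r = 0
    · rwa [ha', if_pos hne]
    · have h1 := hlog r' (hflux r' h0 hV) ρ hρ0 hρ.le hne
      have h2 : 0 < Real.log (ρ / a') := by
        have h3 : 0 < h r := lt_of_le_of_ne (hu.flux_nonneg hq r) (Ne.symm hne)
        have := hu.pos ρ
        rw [← h1] at this
        exact (mul_pos_iff_of_pos_left h3).1 this
      have h4 := (Real.log_pos_iff (div_pos hρ0 (hpos hne)).le).1 h2
      rwa [one_lt_div (hpos hne)] at h4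
  · have hρ0 := h0.trans_lt hρ
    have hq' := hflux r' h0 hV
    rw [hu.scatteringEnergy_eq hq' hw hρ0 hρ.le]
    congr 1
    have e : h r' = h r := by
      rcases le_total r r' with h1 | h1
      · exact hu.flux_eq hq h1
      · exact (hu.flux_eq hq' h1).symm
    rw [e]
    by_cases hne : h r = 0
    · rw [ha', if_pos hne, hne]
      simp
    · have h1 := hlog r' hq' ρ hρ0 hρ.le hne
      rw [← h1]
      field_simp
  · by_cases hne : h r = 0
    · rw [ha', if_pos hne, hne]
      simp
    · rw [← hlog r hq ρ hρ hrρ hne]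
      field_simp

end IsRadialSolution
end AnnularPotential

/-! ### Monotonicity, and upper bounds by trial functions. -/

section Comparison

theorem scatteringEnergy_mono {v w : Plane → ℝ≥0∞} (h : ∀ x, w x ≤ v x) (ρ : ℝ) :
    scatteringEnergy w ρ ≤ scatteringEnergy v ρ := by
  unfold scatteringEnergy
  gcongr
  exact h _

theorem HasCompactScatteringLength.mono {v w : Plane → ℝ≥0∞} {a b : ℝ}
    (hw : HasCompactScatteringLength w b) (hv : HasCompactScatteringLength v a)
    (h : ∀ x, w x ≤ v x) : b ≤ a := by
  obtain ⟨r, hr, hV⟩ := hv.compact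
  have hW : VanishesBeyond w r := fun x hx => le_antisymm ((h x).trans (hV x hx).le) zero_le
  have hlt : r < r + 1 := by linarith
  have ha := hv.lt r _ hr hV hlt
  have hb := hw.lt r _ hr hW hlt
  have hE := scatteringEnergy_mono h (r + 1)
  rw [hv.energy r _ hr hV hlt, hw.energy r _ hr hW hlt] at hE
  rcases hw.nonneg.eq_or_lt with hb0 | hb0
  · rw [← hb0]; exact hv.nonneg
  · have hb1 : 0 < Real.log ((r + 1) / b) := Real.log_pos ((one_lt_div hb0).2 hb)
    have h2 : 0 < 2 * Real.pi / Real.log ((r + 1) / b) := by positivity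
    -- Positivity of the smaller energy excludes `a = 0`, for which this quotient would be `0`.
    have h3 : 0 < 2 * Real.pi / Real.log ((r + 1) / a) :=
      ENNReal.ofReal_pos.1 ((ENNReal.ofReal_pos.2 h2).trans_le hE)
    have hE' := (ENNReal.ofReal_le_ofReal_iff h3.le).1 hE
    have ha0 : 0 < a := by
      rcases hv.nonneg.eq_or_lt with ha0 | ha0
      · rw [← ha0] at h3
        simp at h3
      · exact ha0
    have ha1 : 0 < Real.log ((r + 1) / a) := Real.log_pos ((one_lt_div ha0).2 ha)
    rw [div_le_div_iff_of_pos_left (by positivity) hb1 ha1] at hE'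
    have h4 := (Real.log_le_log_iff (by positivity) (by positivity)).1 hE'
    rwa [div_le_div_iff_of_pos_left (by positivity) ha0 hb0] at h4

/-- Every radial trial function on `B(0, R)`, continued by a multiple of `log (|x| / α)`, bounds
the scattering length `α` from above. -/
theorem HasCompactScatteringLength.two_pi_div_log_le_of_trial {v : Plane → ℝ≥0∞} {α a R : ℝ}
    (hα : HasCompactScatteringLength v α) (hα0 : 0 < α) (hαa : α ≤ a) (haR : a < R)
    {p : ℝ → ℝ} (hp : Measurable p) {B : ℝ} (hB : ∀ t, |p t| ≤ B) {s : ℝ} (hs : 0 < s)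
    (h0 : ∀ t ≤ s, p t = 0) :
    ENNReal.ofReal (2 * Real.pi / Real.log (R / α)) ≤
      (∫⁻ x in Metric.ball (0 : Plane) R, (‖(p ‖x‖ / ‖x‖) • x‖ₑ ^ 2 +
        (1 / 2) * v x * ‖1 - ∫ t in ‖x‖..R, p t‖ₑ ^ 2)) +
      ENNReal.ofReal (1 / Real.log (R / a) ^ 2) * ((1 / 2) *
        ∫⁻ x in {x : Plane | R < ‖x‖}, v x * ENNReal.ofReal (Real.log (‖x‖ / a) ^ 2)) := by
  obtain ⟨r, hr, hV⟩ := hα.compact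
  set ρ := max r R + 1 with hρd
  have hrρ : r < ρ := (le_max_left r R).trans_lt (lt_add_one _)
  have hRρ : R < ρ := (le_max_right r R).trans_lt (lt_add_one _)
  have ha0 : 0 < a := hα0.trans_le hαa
  have hR0 : 0 < R := ha0.trans haR
  have hρ0 : 0 < ρ := hR0.trans hRρ
  set Λ := Real.log (ρ / α) with hΛ
  set M := Real.log (R / α) with hM
  set L := Real.log (R / a) with hL
  have hL0 : 0 < L := Real.log_pos ((one_lt_div ha0).2 haR)
  have hLM : L ≤ M := Real.log_le_log (by positivity) (by gcongr)
  have hM0 : 0 < M := hL0.trans_le hLM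
  have hΛM : Λ = M + Real.log (ρ / R) := by
    rw [hΛ, hM, ← Real.log_mul (by positivity) (by positivity)]
    congr 1
    field_simp
  have hlR : 0 < Real.log (ρ / R) := Real.log_pos ((one_lt_div hR0).2 hRρ)
  have hΛ0 : 0 < Λ := by linarith
  -- The factor that makes the rescaled inner function meet the logarithm `log (|x| / α) / Λ` at
  -- `|x| = R`.
  set κ := M / Λ with hκ
  have hκ0 : 0 < κ := div_pos hM0 hΛ0
  set P : ℝ → ℝ := fun t => if t ≤ R then κ * p t else 1 / Λ * t⁻¹ with hP
  have mP : Measurable P :=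
    Measurable.ite measurableSet_Iic (hp.const_mul κ) (measurable_inv.const_mul _)
  have hB0 : 0 ≤ B := (abs_nonneg _).trans (hB 0)
  have bP : ∀ t, |P t| ≤ κ * B + 1 / Λ * R⁻¹ := by
    intro t
    simp only [hP]
    split_ifs with ht
    · rw [abs_mul, abs_of_pos hκ0]
      have := mul_le_mul_of_nonneg_left (hB t) hκ0.le
      have : 0 < 1 / Λ * R⁻¹ := by positivity
      linarith
    · push Not at ht
      have ht0 := hR0.trans ht
      rw [abs_of_pos (by positivity)]
      have : 1 / Λ * t⁻¹ ≤ 1 / Λ * R⁻¹ := by gcongr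
      have : 0 ≤ κ * B := by positivity
      linarith
  have zP : ∀ t ≤ min s R, P t = 0 := by
    intro t ht
    simp only [hP, if_pos (ht.trans (min_le_right _ _)), h0 t (ht.trans (min_le_left _ _)),
      mul_zero]
  obtain ⟨H, Hb⟩ := hasH1Gradient_radial mP bP (lt_min hs hR0) ((min_le_right _ _).trans_lt hRρ)
    zP 1
  have iP : ∀ x y, IntervalIntegrable P volume x y := fun x y =>
    intervalIntegrable_const.mono_fun (f := fun _ => κ * B + 1 / Λ * R⁻¹) mP.aestronglyMeasurable
      (.of_forall fun t => (bP t).trans (le_abs_self _))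
  have outer : ∀ t, R ≤ t → 1 - ∫ τ in t..ρ, P τ = Real.log (t / α) / Λ ∨ ρ < t := by
    intro t ht
    rcases lt_or_ge ρ t with h1 | h1
    · exact Or.inr h1
    left
    have ht0 := hR0.trans_le ht
    have e : ∫ τ in t..ρ, P τ = ∫ τ in t..ρ, 1 / Λ * τ⁻¹ := by
      rw [intervalIntegral.integral_of_le h1, intervalIntegral.integral_of_le h1]
      refine setIntegral_congr_fun measurableSet_Ioc fun τ hτ => ?_
      simp only [hP, if_neg (not_le.2 (ht.trans_lt hτ.1))]
    rw [e, intervalIntegral.integral_const_mul, integral_inv_of_pos ht0 hρ0]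
    have : Λ = Real.log (t / α) + Real.log (ρ / t) := by
      rw [hΛ, ← Real.log_mul (by positivity) (by positivity)]
      congr 1
      field_simp
    field_simp
    linarith
  have inner : ∀ t, t ≤ R → 1 - ∫ τ in t..ρ, P τ = κ * (1 - ∫ τ in t..R, p τ) := by
    intro t ht
    have e1 : ∫ τ in t..ρ, P τ = (∫ τ in t..R, P τ) + ∫ τ in R..ρ, P τ :=
      (intervalIntegral.integral_add_adjacent_intervals (iP _ _) (iP _ _)).symm
    have e2 : ∫ τ in t..R, P τ = κ * ∫ τ in t..R, p τ := by
      rw [← intervalIntegral.integral_const_mul, intervalIntegral.integral_of_le ht,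
        intervalIntegral.integral_of_le ht]
      refine setIntegral_congr_fun measurableSet_Ioc fun τ hτ => ?_
      simp only [hP, if_pos hτ.2]
    have e3 := (outer R le_rfl).resolve_right hRρ.not_gt
    rw [e1, e2]
    rw [← hM, ← hκ] at e3
    linarith
  set Y : ℝ≥0∞ := ∫⁻ x in {x : Plane | R < ‖x‖}, v x * ENNReal.ofReal (Real.log (‖x‖ / a) ^ 2)
    with hY
  set Z : ℝ≥0∞ := ∫⁻ x in Metric.ball (0 : Plane) R, (‖(p ‖x‖ / ‖x‖) • x‖ₑ ^ 2 +
        (1 / 2) * v x * ‖1 - ∫ t in ‖x‖..R, p t‖ₑ ^ 2) with hZ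
  have hE : ENNReal.ofReal (2 * Real.pi / Λ) ≤ ∫⁻ x in Metric.ball (0 : Plane) ρ,
      (‖(P ‖x‖ / ‖x‖) • x‖ₑ ^ 2 + (1 / 2) * v x * ‖1 - ∫ t in ‖x‖..ρ, P t‖ₑ ^ 2) := by
    rw [hΛ, ← hα.energy r ρ hr hV hrρ]
    exact (iInf₂_le _ _).trans (iInf₂_le H Hb)
  have hsub : Metric.ball (0 : Plane) R ⊆ Metric.ball 0 ρ := Metric.ball_subset_ball hRρ.le
  rw [← union_sdiff_cancel hsub, lintegral_union (measurableSet_ball.diff measurableSet_ball)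
    disjoint_sdiff_right] at hE
  have hin : ∫⁻ x in Metric.ball (0 : Plane) R,
      (‖(P ‖x‖ / ‖x‖) • x‖ₑ ^ 2 + (1 / 2) * v x * ‖1 - ∫ t in ‖x‖..ρ, P t‖ₑ ^ 2) =
      ENNReal.ofReal (κ ^ 2) * Z := by
    rw [hZ, ← lintegral_const_mul' _ _ ENNReal.ofReal_ne_top]
    refine setLIntegral_congr_fun measurableSet_ball fun x hx => ?_
    have hx' : ‖x‖ ≤ R := by simpa using (Metric.ball_subset_closedBall hx)
    have e1 : P ‖x‖ = κ * p ‖x‖ := if_pos hx'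
    have e2 : ENNReal.ofReal (κ ^ 2) = ‖κ‖ₑ ^ 2 := by
      rw [ENNReal.ofReal_pow hκ0.le, Real.enorm_eq_ofReal hκ0.le]
    rw [inner _ hx', e1, mul_div_assoc, mul_smul, enorm_smul, enorm_mul, e2]
    ring
  have hout : ∫⁻ x in Metric.ball (0 : Plane) ρ \ Metric.ball 0 R,
      (‖(P ‖x‖ / ‖x‖) • x‖ₑ ^ 2 + (1 / 2) * v x * ‖1 - ∫ t in ‖x‖..ρ, P t‖ₑ ^ 2) ≤
      ENNReal.ofReal (2 * Real.pi * Real.log (ρ / R) / Λ ^ 2) +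
        ENNReal.ofReal (κ ^ 2) * (ENNReal.ofReal (1 / L ^ 2) * ((1 / 2) * Y)) := by
    set A : Set Plane := {x | R < ‖x‖ ∧ ‖x‖ < ρ} with hA
    have mA : MeasurableSet A := by
      rw [hA]
      exact (measurableSet_lt measurable_const measurable_norm).inter
        (measurableSet_lt measurable_norm measurable_const)
    have hae : (Metric.ball (0 : Plane) ρ \ Metric.ball 0 R : Set Plane) =ᵐ[volume] A := by
      have : ∀ᵐ x : Plane, ‖x‖ ≠ R :=
        ae_plane_norm ((measure_eq_zero_iff_ae_notMem (s := {R})).1 (by simp))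
      filter_upwards [this] with x hx
      apply propext
      change (x ∈ Metric.ball (0 : Plane) ρ \ Metric.ball 0 R) ↔ (R < ‖x‖ ∧ ‖x‖ < ρ)
      simp only [Set.mem_sdiff, mem_ball_zero_iff, not_lt]
      exact ⟨fun h => ⟨lt_of_le_of_ne h.2 (Ne.symm hx), h.1⟩, fun h => ⟨h.2, h.1.le⟩⟩
    rw [setLIntegral_congr hae, lintegral_add_left (by fun_prop)]
    refine add_le_add ?_ ?_
    · have mf : Measurable ((Ioo R ρ).indicator fun t => ENNReal.ofReal ((1 / Λ * t⁻¹) ^ 2)) :=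
        Measurable.indicator (by fun_prop) measurableSet_Ioo
      calc _ ≤ ∫⁻ x : Plane, (Ioo R ρ).indicator
              (fun t => ENNReal.ofReal ((1 / Λ * t⁻¹) ^ 2)) ‖x‖ := by
            rw [← lintegral_indicator mA]
            refine lintegral_mono fun x => ?_
            by_cases hx : x ∈ A
            · have h1 : ‖x‖ ∈ Ioo R ρ := hx
              have h2 : P ‖x‖ = 1 / Λ * ‖x‖⁻¹ := if_neg (not_le.2 hx.1)
              rw [indicator_of_mem hx, indicator_of_mem h1, ← ofReal_norm,
                ← ENNReal.ofReal_pow (norm_nonneg _)]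
              apply ENNReal.ofReal_le_ofReal
              rw [← h2, ← sq_abs (P ‖x‖)]
              have := norm_nonneg ((P ‖x‖ / ‖x‖) • x)
              gcongr
              exact IsRadialSolution.norm_div_smul_self_le _ _
            · rw [indicator_of_notMem hx]
              exact zero_le
        _ = ENNReal.ofReal (2 * Real.pi) * ∫⁻ t in Ioo R ρ, ENNReal.ofReal ((1 / Λ ^ 2) * t⁻¹) := by
            rw [lintegral_plane_norm mf, ← lintegral_indicator measurableSet_Ioi,
              ← lintegral_indicator measurableSet_Ioo]
            congr 1
            refine lintegral_congr fun t => ?_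
            by_cases ht : t ∈ Ioo R ρ
            · have ht0 : 0 < t := hR0.trans ht.1
              rw [indicator_of_mem (show t ∈ Ioi 0 from ht0), indicator_of_mem ht,
                indicator_of_mem ht, ← ENNReal.ofReal_mul ht0.le]
              congr 1
              field_simp
            · rw [indicator_of_notMem ht]
              by_cases ht0 : t ∈ Ioi (0 : ℝ) <;> simp [indicator, ht0, ht]
        _ = _ := by
            have hi : IntervalIntegrable (fun t : ℝ => (1 / Λ ^ 2) * t⁻¹) volume R ρ := by
              refine (intervalIntegral.intervalIntegrable_inv (fun t ht => ?_)
                continuousOn_id).const_mul _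
              rw [uIcc_of_le hRρ.le] at ht
              exact (hR0.trans_le ht.1).ne'
            rw [← ofReal_integral_eq_lintegral_ofReal, ← integral_Ioc_eq_integral_Ioo,
              ← intervalIntegral.integral_of_le hRρ.le, intervalIntegral.integral_const_mul,
              integral_inv_of_pos hR0 hρ0, ← ENNReal.ofReal_mul (by positivity)]
            · congr 1
              ring
            · exact hi.1.mono_set Ioo_subset_Ioc_self
            · refine (ae_restrict_iff' measurableSet_Ioo).2 (.of_forall fun t ht => ?_)
              have ht0 : 0 < t := hR0.trans ht.1
              change 0 ≤ 1 / Λ ^ 2 * t⁻¹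
              positivity
    · rw [hY, ← lintegral_const_mul' _ _ (by simp), ← lintegral_const_mul' _ _ ENNReal.ofReal_ne_top,
        ← lintegral_const_mul' _ _ ENNReal.ofReal_ne_top]
      refine (setLIntegral_mono' mA fun x hx => ?_).trans
        (lintegral_mono_set (t := {x : Plane | R < ‖x‖}) fun x hx => hx.1)
      have hx0 : 0 < ‖x‖ := hR0.trans hx.1
      rw [(outer _ hx.1.le).resolve_right hx.2.not_gt]
      have hτ : 0 < Real.log (‖x‖ / R) := Real.log_pos ((one_lt_div hR0).2 hx.1)
      have h1 : Real.log (‖x‖ / α) = M + Real.log (‖x‖ / R) := by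
        rw [hM, ← Real.log_mul (by positivity) (by positivity)]
        congr 1
        field_simp
      have h2 : Real.log (‖x‖ / a) = L + Real.log (‖x‖ / R) := by
        rw [hL, ← Real.log_mul (by positivity) (by positivity)]
        congr 1
        field_simp
      -- With `τ = log (|x| / R)` this is `(M + τ) / M ≤ (L + τ) / L`, which holds because `L ≤ M`,
      -- that is, `α ≤ a`.
      have h3 : ‖Real.log (‖x‖ / α) / Λ‖ₑ ^ 2 ≤ ENNReal.ofReal (κ ^ 2) *
          (ENNReal.ofReal (1 / L ^ 2) * ENNReal.ofReal (Real.log (‖x‖ / a) ^ 2)) := by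
        have h4 : 0 ≤ Real.log (‖x‖ / α) / Λ := by
          rw [h1]
          positivity
        rw [Real.enorm_eq_ofReal h4, ← ENNReal.ofReal_pow h4, ← ENNReal.ofReal_mul (by positivity),
          ← ENNReal.ofReal_mul (by positivity)]
        apply ENNReal.ofReal_le_ofReal
        have h5 : κ ^ 2 * (1 / L ^ 2 * Real.log (‖x‖ / a) ^ 2) =
            (κ * (Real.log (‖x‖ / a) / L)) ^ 2 := by ring
        rw [h5]
        refine pow_le_pow_left₀ h4 ?_ 2
        rw [hκ, h1, h2, div_mul_div_comm, div_le_div_iff₀ hΛ0 (by positivity)]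
        nlinarith [mul_le_mul_of_nonneg_right hLM hτ.le,
          mul_le_mul_of_nonneg_right (mul_le_mul_of_nonneg_right hLM hτ.le) hΛ0.le]
      calc (1 / 2) * v x * ‖Real.log (‖x‖ / α) / Λ‖ₑ ^ 2 ≤ (1 / 2) * v x *
            (ENNReal.ofReal (κ ^ 2) *
              (ENNReal.ofReal (1 / L ^ 2) * ENNReal.ofReal (Real.log (‖x‖ / a) ^ 2))) := by gcongr
        _ = _ := by ring
  -- The energy `2π / Λ` splits at `R` into `κ² · 2π / M` and the Dirichlet energy of the outer
  -- logarithm. The latter cancels from both sides, and division by `κ²` finishes the proof.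
  have hfin : ENNReal.ofReal (2 * Real.pi / Λ) =
      ENNReal.ofReal (κ ^ 2) * ENNReal.ofReal (2 * Real.pi / M) +
        ENNReal.ofReal (2 * Real.pi * Real.log (ρ / R) / Λ ^ 2) := by
    rw [← ENNReal.ofReal_mul (by positivity), ← ENNReal.ofReal_add (by positivity)
      (by positivity)]
    congr 1
    rw [hκ]
    field_simp
    rw [hΛM]
  rw [hin, hfin] at hE
  have hE2 : ENNReal.ofReal (κ ^ 2) * ENNReal.ofReal (2 * Real.pi / M) +
      ENNReal.ofReal (2 * Real.pi * Real.log (ρ / R) / Λ ^ 2) ≤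
      ENNReal.ofReal (κ ^ 2) * (Z + ENNReal.ofReal (1 / L ^ 2) * ((1 / 2) * Y)) +
      ENNReal.ofReal (2 * Real.pi * Real.log (ρ / R) / Λ ^ 2) := by
    refine (hE.trans (add_le_add le_rfl hout)).trans_eq ?_
    ring
  have hE3 := (ENNReal.add_le_add_iff_right ENNReal.ofReal_ne_top).1 hE2
  have hκ2 : ENNReal.ofReal (κ ^ 2) ≠ 0 := (ENNReal.ofReal_pos.2 (by positivity)).ne'
  exact (ENNReal.mul_le_mul_iff_right hκ2 ENNReal.ofReal_ne_top).1 hE3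

end Comparison

/-! ### Bounded truncations, and integrability of the potential outside the scattering length. -/

section Truncations

theorem tendsto_lintegral_min {f : Plane → ℝ≥0∞} (hf : Measurable f) (μ : Measure Plane) :
    Tendsto (fun n : ℕ => ∫⁻ x, min (f x) n ∂μ) atTop (𝓝 (∫⁻ x, f x ∂μ)) := by
  refine lintegral_tendsto_of_tendsto_of_monotone
    (fun n => (hf.min measurable_const).aemeasurable)
    (.of_forall fun x m n hmn => min_le_min le_rfl (by exact_mod_cast hmn))
    (.of_forall fun x => ?_)
  have h : Tendsto (fun n : ℕ => min (f x) n) atTop (𝓝 (min (f x) ⊤)) :=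
    tendsto_const_nhds.min ENNReal.tendsto_nat_nhds_top
  rwa [min_top_right] at h

theorem measurableSet_annulus (a b : ℝ) : MeasurableSet {x : Plane | a < ‖x‖ ∧ ‖x‖ < b} :=
  (measurableSet_lt measurable_const measurable_norm).inter
    (measurableSet_lt measurable_norm measurable_const)

theorem IsRadial.indicator {f : Plane → ℝ≥0∞} (hf : IsRadial f) {S : Set Plane}
    (hS : ∀ x y : Plane, ‖x‖ = ‖y‖ → x ∈ S → y ∈ S) : IsRadial (S.indicator f) := by
  intro x y hxy
  by_cases hx : x ∈ S
  · rw [indicator_of_mem hx, indicator_of_mem (hS x y hxy hx), hf x y hxy]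
  · rw [indicator_of_notMem hx, indicator_of_notMem fun hy => hx (hS y x hxy.symm hy)]

theorem IsRadial.annulus_indicator {f : Plane → ℝ≥0∞} (hf : IsRadial f) (a b : ℝ) :
    IsRadial ({x : Plane | a < ‖x‖ ∧ ‖x‖ < b}.indicator f) :=
  hf.indicator fun x y hxy hx => by simpa only [Set.mem_ofPred_eq, ← hxy] using hx

theorem IsRadial.min_const {f : Plane → ℝ≥0∞} (hf : IsRadial f) (M : ℝ≥0∞) :
    IsRadial fun x => min (f x) M := fun x y hxy => by simp only [hf x y hxy]

/-- A bounded radial potential that vanishes outside of an annulus is given by a coefficient of the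
radial equation. -/
theorem exists_radialSolution_of_bounded {w : Plane → ℝ≥0∞} (mw : Measurable w)
    (hrad : IsRadial w) {M : ℝ≥0∞} (hM : M ≠ ⊤) (hwM : ∀ x, w x ≤ M) {s r : ℝ} (hs : 0 < s)
    (hr : 0 ≤ r) (hws : ∀ x, ‖x‖ ≤ s → w x = 0) (hwr : VanishesBeyond w r) :
    ∃ q u h, IsAnnularCoeff q s r ∧ IsRadialSolution q s u h ∧
      (∀ x, (1 / 2) * w x = ENNReal.ofReal (q ‖x‖ / ‖x‖)) ∧
      (1 / 2) * ∫⁻ x, w x ≤ ENNReal.ofReal (2 * Real.pi * h r) := by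
  set e : Plane := EuclideanSpace.single 0 1 with he
  have ne : ‖e‖ = 1 := by simp [he]
  have nte : ∀ t : ℝ, 0 ≤ t → ‖t • e‖ = t := fun t ht => by
    rw [norm_smul, ne, mul_one, Real.norm_of_nonneg ht]
  have hfin : ∀ x, w x ≠ ⊤ := fun x => ((hwM x).trans_lt hM.lt_top).ne
  -- The factor `t / 2` makes `q |x| / |x|` equal to `w / 2`, the coefficient in the energy.
  set q : ℝ → ℝ := fun t => if t ≤ 0 then 0 else t / 2 * (w (t • e)).toReal with hqd
  have zs : ∀ t ≤ s, q t = 0 := by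
    intro t ht
    simp only [hqd]
    split_ifs with h0
    · rfl
    · rw [hws _ (by rw [nte t (not_le.1 h0).le]; exact ht)]
      simp
  have zr : ∀ t, r ≤ t → q t = 0 := by
    intro t ht
    simp only [hqd]
    split_ifs with h0
    · rfl
    · rw [hwr _ (by rw [nte t (not_le.1 h0).le]; exact ht)]
      simp
  have q0 : ∀ t, 0 ≤ q t := by
    intro t
    simp only [hqd]
    split_ifs with h0
    · exact le_rfl
    · have := (not_le.1 h0).le
      positivity
  have mq : Measurable q := by
    refine Measurable.ite measurableSet_Iic measurable_const ?_
    exact (measurable_id.div_const 2).mul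
      (mw.comp (measurable_id.smul_const e)).ennreal_toReal
  have hq : IsAnnularCoeff q s r := by
    refine ⟨mq, q0, ⟨r / 2 * M.toReal, fun t => ?_⟩, hs, hr, zs, zr⟩
    have hB : 0 ≤ r / 2 * M.toReal := by positivity
    rcases le_total r t with h1 | h1
    · rw [zr t h1]; exact hB
    · simp only [hqd]
      split_ifs with h0
      · exact hB
      · have := (not_le.1 h0).le
        gcongr
        exact hwM _
  obtain ⟨B, hB⟩ := hq.bounded
  obtain ⟨u, h, hu⟩ := exists_isRadialSolution mq q0 hB hs zs
  have hw : ∀ x, (1 / 2) * w x = ENNReal.ofReal (q ‖x‖ / ‖x‖) := by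
    intro x
    rcases eq_or_ne x 0 with rfl | hx
    · rw [hws 0 (by simpa using hs.le)]
      simp
    · have hx0 : 0 < ‖x‖ := norm_pos_iff.2 hx
      have e1 : q ‖x‖ / ‖x‖ = 1 / 2 * (w x).toReal := by
        simp only [hqd, if_neg hx0.not_ge]
        rw [hrad (‖x‖ • e) x (nte _ hx0.le)]
        field_simp
      rw [e1, ENNReal.ofReal_mul (by norm_num), ENNReal.ofReal_toReal (hfin x)]
      congr 1
      rw [ENNReal.ofReal_div_of_pos (by norm_num)]
      simp
  refine ⟨q, u, h, hq, hu, hw, ?_⟩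
  have iq : IntegrableOn q (Ioc 0 r) := by
    refine Integrable.mono' (g := fun _ => B) (by simp) mq.aestronglyMeasurable
      (.of_forall fun t => ?_)
    rw [Real.norm_of_nonneg (q0 t)]
    exact hB t
  calc (1 / 2) * ∫⁻ x, w x = ∫⁻ x : Plane, ENNReal.ofReal (q ‖x‖ / ‖x‖) := by
        rw [← lintegral_const_mul' _ _ (by simp)]
        exact lintegral_congr hw
    _ = ENNReal.ofReal (2 * Real.pi) * ∫⁻ t in Ioc 0 r, ENNReal.ofReal (q t) := by
        rw [lintegral_plane_norm (f := fun t => ENNReal.ofReal (q t / t))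
          (mq.div measurable_id).ennreal_ofReal, ← lintegral_indicator measurableSet_Ioi,
          ← lintegral_indicator measurableSet_Ioc]
        congr 1
        refine lintegral_congr fun t => ?_
        by_cases ht0 : 0 < t
        · rw [indicator_of_mem (show t ∈ Ioi 0 from ht0), ← ENNReal.ofReal_mul ht0.le,
            mul_div_cancel₀ _ ht0.ne']
          by_cases htr : t ≤ r
          · rw [indicator_of_mem (show t ∈ Ioc 0 r from ⟨ht0, htr⟩)]
          · rw [indicator_of_notMem (fun h => htr h.2), zr t (not_le.1 htr).le,
              ENNReal.ofReal_zero]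
        · rw [indicator_of_notMem (show t ∉ Ioi 0 from ht0), indicator_of_notMem (show t ∉ Ioc 0 r from fun h => ht0 h.1)]
    _ = ENNReal.ofReal (2 * Real.pi * ∫ t in (0)..r, q t) := by
        rw [← ofReal_integral_eq_lintegral_ofReal iq (.of_forall q0),
          ← ENNReal.ofReal_mul (by positivity), intervalIntegral.integral_of_le hr]
    _ ≤ _ := ENNReal.ofReal_le_ofReal
        (mul_le_mul_of_nonneg_left (hu.integral_le_flux hq) (by positivity))

/-- A potential with a scattering length is the limit of compactly supported ones. -/
theorem HasScatteringLength.exists_compact_approx {v : Plane → ℝ≥0∞} {a : ℝ}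
    (hv : HasScatteringLength v a) : ∃ (V : ℕ → Plane → ℝ≥0∞) (α : ℕ → ℝ),
      (∀ n, HasCompactScatteringLength (V n) (α n)) ∧ (∀ n x, V n x ≤ v x) ∧
      (∀ (n : ℕ) x, ‖x‖ < n → V n x = v x) ∧ (∀ n, α n ≤ a) ∧ Tendsto α atTop (𝓝 a) := by
  rcases hv with hv | ⟨-, α, hα, hlim⟩
  · exact ⟨fun _ => v, fun _ => a, fun _ => hv, fun _ _ => le_rfl, fun _ _ _ => rfl,
      fun _ => le_rfl, tendsto_const_nhds⟩
  · have hmono : Monotone α := fun m n hmn => by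
      refine (hα m).mono (hα n) fun x => ?_
      exact indicator_le_indicator_of_subset
        (Metric.ball_subset_ball (by exact_mod_cast hmn)) (fun _ => zero_le) x
    exact ⟨_, α, hα, fun n x => indicator_le_self _ _ x,
      fun n x hx => indicator_of_mem (by simpa using hx) _, hmono.ge_of_tendsto hlim, hlim⟩

theorem HasScatteringLength.nonneg {v : Plane → ℝ≥0∞} {a : ℝ} (hv : HasScatteringLength v a) :
    0 ≤ a := by
  obtain ⟨V, α, hV, -, -, hα, -⟩ := hv.exists_compact_approx
  exact (hV 0).nonneg.trans (hα 0)

/-- Once `n > R`, the approximant `V n` agrees with `v` wherever `w` can be nonzero, so `w ≤ V n`.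
-/
theorem HasCompactScatteringLength.le_of_le {v w : Plane → ℝ≥0∞} {a b R : ℝ}
    (hw : HasCompactScatteringLength w b) (hv : HasScatteringLength v a) (hwv : ∀ x, w x ≤ v x)
    (hR : VanishesBeyond w R) : b ≤ a := by
  obtain ⟨V, α, hV, -, heq, hα, -⟩ := hv.exists_compact_approx
  obtain ⟨n, hn⟩ := exists_nat_gt R
  refine (hw.mono (hV n) fun x => ?_).trans (hα n)
  rcases lt_or_ge ‖x‖ n with h | h
  · rw [heq n x h]; exact hwv x
  · rw [hR x (hn.le.trans h)]; exact zero_le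

/-- Outside of the scattering length, the potential is integrable. -/
theorem HasScatteringLength.lintegral_annulus_le {v : Plane → ℝ≥0∞} {a : ℝ}
    (hv : HasScatteringLength v a) (mv : Measurable v) (hrad : IsRadial v) (ha : 0 < a)
    {s R : ℝ} (has : a < s) (hsR : s < R) :
    (1 / 2) * ∫⁻ x in {x : Plane | s < ‖x‖ ∧ ‖x‖ < R}, v x ≤
      ENNReal.ofReal (2 * Real.pi / Real.log (s / a)) := by
  have hs : 0 < s := ha.trans has
  have hR : 0 < R := hs.trans hsR
  have hl : 0 < Real.log (s / a) := Real.log_pos ((one_lt_div ha).2 has)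
  refine le_of_tendsto' (ENNReal.Tendsto.const_mul
    (tendsto_lintegral_min mv (volume.restrict {x : Plane | s < ‖x‖ ∧ ‖x‖ < R}))
    (Or.inr (by simp))) fun n => ?_
  set w : Plane → ℝ≥0∞ := {x : Plane | s < ‖x‖ ∧ ‖x‖ < R}.indicator fun x => min (v x) n with hwd
  have hwn : ∀ x, w x ≤ n := fun x => (indicator_le_self _ _ x).trans (min_le_right _ _)
  have hwv : ∀ x, w x ≤ v x := fun x => (indicator_le_self _ _ x).trans (min_le_left _ _)
  have hwR : VanishesBeyond w R := fun x hx => indicator_of_notMem (fun h => hx.not_gt h.2) _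
  obtain ⟨q, u, h, hq, hu, hw, hm⟩ := exists_radialSolution_of_bounded
    ((mv.min measurable_const).indicator (measurableSet_annulus s R))
    ((hrad.min_const n).annulus_indicator s R) (ENNReal.natCast_ne_top n) hwn hs hR.le
    (fun x hx => indicator_of_notMem (fun h => hx.not_gt h.1) _) hwR
  rw [lintegral_indicator (measurableSet_annulus s R)] at hm
  refine hm.trans (ENNReal.ofReal_le_ofReal ?_)
  obtain ⟨a', ha', hlog⟩ := hu.exists_scatteringLength hq hw
  have h1 := hlog R hR le_rfl
  rcases (hu.flux_nonneg hq R).eq_or_lt with h0 | h0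
  · rw [← h0, mul_zero]
    positivity
  · have ha'0 : 0 < a' := by
      refine ha'.nonneg.lt_of_ne fun h2 => ?_
      have := div_pos (hu.pos R) h0
      rw [← h1, ← h2] at this
      simp at this
    have h2 : a' ≤ a := ha'.le_of_le hv hwv hwR
    have h3 : Real.log (R / a) ≤ u R / h R := by
      rw [← h1]
      exact Real.log_le_log (by positivity) (by gcongr)
    have h4 := hu.sub_le_log hq hs hsR.le
    rw [hu.eq_one s le_rfl] at h4
    have h5 : Real.log (R / a) = Real.log (R / s) + Real.log (s / a) := by
      rw [← Real.log_mul (by positivity) (by positivity)]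
      congr 1
      field_simp
    rw [le_div_iff₀ h0, h5] at h3
    -- As `u = 1` up to `s`, `u R ≤ 1 + h R * log (R / s)`, while `a' ≤ a` gives `h R * log (R / a)
    -- ≤ u R`. The logarithms of `R` cancel, and the bound on the flux is a bound on the mass.
    have h6 : Real.log (s / a) * h R ≤ 1 := by linarith
    rw [le_div_iff₀ hl]
    nlinarith [Real.pi_pos]

end Truncations

/-! ### Choice of the truncated potential. -/

section Selection

/-- The annuli `ρ n ≤ |x| < R` decrease to the empty set and have finite mass. It allows the support
to stay strictly inside `B(0, R)` at a small cost. -/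
theorem exists_lintegral_outer_le {v : Plane → ℝ≥0∞} {s R : ℝ} (hsR : s < R)
    (hfin : ∫⁻ x in {x : Plane | s < ‖x‖ ∧ ‖x‖ < R}, v x ≠ ⊤) {η : ℝ≥0∞} (hη : 0 < η) :
    ∃ r, s < r ∧ r < R ∧ ∫⁻ x in {x : Plane | r ≤ ‖x‖ ∧ ‖x‖ < R}, v x ≤ η := by
  set ρ : ℕ → ℝ := fun n => R - (R - s) / (n + 2) with hρ
  have hd : 0 < R - s := sub_pos.2 hsR
  have h1 : ∀ n, s < ρ n := fun n => by
    have : (R - s) / ((n : ℝ) + 2) < R - s := by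
      rw [div_lt_iff₀ (by positivity)]
      nlinarith [(Nat.cast_nonneg n : (0 : ℝ) ≤ n)]
    simp only [hρ]
    linarith
  have h2 : ∀ n, ρ n < R := fun n => by
    have : 0 < (R - s) / ((n : ℝ) + 2) := by positivity
    simp only [hρ]
    linarith
  have hmono : Monotone ρ := fun m n hmn => by
    have : (m : ℝ) ≤ n := by exact_mod_cast hmn
    simp only [hρ]
    gcongr
  have hlim : Tendsto ρ atTop (𝓝 R) := by
    have : Tendsto (fun n : ℕ => (R - s) / ((n : ℝ) + 2)) atTop (𝓝 0) :=
      tendsto_const_nhds.div_atTop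
        (tendsto_atTop_add_const_right _ _ tendsto_natCast_atTop_atTop)
    simpa [hρ] using this.const_sub R
  set A : ℕ → Set Plane := fun n => {x | ρ n ≤ ‖x‖ ∧ ‖x‖ < R} with hA
  have mA : ∀ n, MeasurableSet (A n) := fun n =>
    (measurableSet_le measurable_const measurable_norm).inter
      (measurableSet_lt measurable_norm measurable_const)
  have hempty : ⋂ n, A n = ∅ := by
    refine eq_empty_of_forall_notMem fun x hx => ?_
    rw [mem_iInter] at hx
    exact (hx 0).2.not_ge (le_of_tendsto' hlim fun n => (hx n).1)
  have key := tendsto_measure_iInter_atTop (μ := volume.withDensity v)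
    (fun n => (mA n).nullMeasurableSet)
    (fun m n hmn x hx => ⟨(hmono hmn).trans hx.1, hx.2⟩) ⟨0, by
      rw [withDensity_apply _ (mA 0)]
      exact ((lintegral_mono_set (t := {x : Plane | s < ‖x‖ ∧ ‖x‖ < R})
        fun x hx => ⟨(h1 0).trans_le hx.1, hx.2⟩).trans_lt hfin.lt_top).ne⟩
  rw [hempty, measure_empty] at key
  obtain ⟨n, hn⟩ := (key.eventually (Iic_mem_nhds hη)).exists
  refine ⟨ρ n, h1 n, h2 n, ?_⟩
  have hn' : volume.withDensity v (A n) ≤ η := hn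
  rwa [withDensity_apply _ (mA n)] at hn'

/-- A bounded potential `w ≤ v` in an annulus inside of `B(0, r)`, whose integral is at most `Θ`,
which nearly agrees with `v` for `|x| > r₀`, and which has integral `Θ` unless `r₀ = 0`. -/
theorem exists_truncation {v : Plane → ℝ≥0∞} (mv : Measurable v) (hrad : IsRadial v) {r : ℝ}
    (hr : 0 < r) {Θ : ℝ≥0∞} (hΘ : Θ ≠ ⊤) {δ : ℝ} (hδ : 0 < δ) {η : ℝ≥0∞} (hη : 0 < η) :
    ∃ (w : Plane → ℝ≥0∞) (r₀ s : ℝ) (k : ℕ), Measurable w ∧ IsRadial w ∧ (∀ x, w x ≤ v x) ∧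
      (∀ x, w x ≤ k) ∧ 0 < s ∧ (∀ x, ‖x‖ ≤ s → w x = 0) ∧ VanishesBeyond w r ∧
      ∫⁻ x, w x ≤ Θ ∧ 0 ≤ r₀ ∧ r₀ ≤ r ∧
      ∫⁻ x in {x : Plane | r₀ < ‖x‖ ∧ ‖x‖ < r}, (v x - w x) ≤ η ∧
      (r₀ = 0 ∨ 0 < r₀ ∧ r₀ = s * (1 + δ) ∧ ∫⁻ x, w x = Θ) := by
  set F : ℝ → ℝ≥0∞ := fun t => ∫⁻ x in {x : Plane | t < ‖x‖ ∧ ‖x‖ < r}, v x with hF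
  have hFanti : Antitone F := fun a b hab => lintegral_mono_set fun x hx => ⟨hab.trans_lt hx.1, hx.2⟩
  set S : Set ℝ := {t | 0 ≤ t ∧ F t ≤ Θ} with hS
  have hrS : r ∈ S := by
    refine ⟨hr.le, ?_⟩
    have : {x : Plane | r < ‖x‖ ∧ ‖x‖ < r} = ∅ :=
      eq_empty_of_forall_notMem fun x hx => lt_asymm hx.1 hx.2
    simp only [hF, this, Measure.restrict_empty, lintegral_zero_measure]
    exact zero_le
  have hbdd : BddBelow S := ⟨0, fun t ht => ht.1⟩
  set r₀ := sInf S with hr₀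
  have h0 : 0 ≤ r₀ := le_csInf ⟨r, hrS⟩ fun t ht => ht.1
  have h0r : r₀ ≤ r := csInf_le hbdd hrS
  -- The infimum is attained: the open annuli with inner radius `r₀ + 1 / (n + 1)` exhaust the one
  -- with inner radius `r₀`.
  have hFr₀ : F r₀ ≤ Θ := by
    have hU : {x : Plane | r₀ < ‖x‖ ∧ ‖x‖ < r} =
        ⋃ n : ℕ, {x : Plane | r₀ + 1 / ((n : ℝ) + 1) < ‖x‖ ∧ ‖x‖ < r} := by
      ext x
      simp only [Set.mem_ofPred_eq, mem_iUnion]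
      constructor
      · rintro ⟨h1, h2⟩
        obtain ⟨n, hn⟩ := exists_nat_one_div_lt (sub_pos.2 h1)
        exact ⟨n, by linarith, h2⟩
      · rintro ⟨n, h1, h2⟩
        have : (0 : ℝ) < 1 / ((n : ℝ) + 1) := by positivity
        exact ⟨by linarith, h2⟩
    have hdir : Directed (· ⊆ ·) fun n : ℕ =>
        {x : Plane | r₀ + 1 / ((n : ℝ) + 1) < ‖x‖ ∧ ‖x‖ < r} := by
      refine Monotone.directed_le fun m n hmn x hx => ⟨?_, hx.2⟩
      have : (1 : ℝ) / ((n : ℝ) + 1) ≤ 1 / ((m : ℝ) + 1) := by gcongr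
      linarith [hx.1]
    simp only [hF]
    rw [hU, setLIntegral_iUnion_of_directed _ hdir]
    refine iSup_le fun n => ?_
    obtain ⟨t, ht, htn⟩ := exists_lt_of_csInf_lt (s := S) (b := r₀ + 1 / ((n : ℝ) + 1)) ⟨r, hrS⟩
      (by rw [← hr₀]; exact lt_add_of_pos_right _ (by positivity))
    exact (hFanti htn.le).trans ht.2
  have hFfin : F r₀ ≠ ⊤ := (hFr₀.trans_lt hΘ.lt_top).ne
  have mann := fun a => measurableSet_annulus a r
  have mmin : ∀ k : ℕ, Measurable fun x => min (v x) k := fun k => mv.min measurable_const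
  rcases h0.eq_or_lt with h00 | h0pos
  -- All of `v` inside `B(0, r)` has mass at most `Θ`; it only has to be capped and cut off near the
  -- origin.
  · set w : ℕ → Plane → ℝ≥0∞ := fun k =>
      {x : Plane | 1 / ((k : ℝ) + 1) < ‖x‖ ∧ ‖x‖ < r}.indicator fun x => min (v x) k with hw
    have mw : ∀ k, Measurable (w k) := fun k => (mmin k).indicator (mann _)
    have hwv : ∀ k x, w k x ≤ v x := fun k x =>
      (indicator_le_self _ _ x).trans (min_le_left _ _)
    have hsub : ∀ k : ℕ, {x : Plane | 1 / ((k : ℝ) + 1) < ‖x‖ ∧ ‖x‖ < r} ⊆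
        {x | r₀ < ‖x‖ ∧ ‖x‖ < r} := fun k x hx => by
      refine ⟨?_, hx.2⟩
      rw [← h00]
      exact lt_trans (by positivity) hx.1
    have hint : ∀ k, ∫⁻ x in {x : Plane | r₀ < ‖x‖ ∧ ‖x‖ < r}, w k x = ∫⁻ x, w k x := fun k => by
      rw [← lintegral_indicator (mann r₀)]
      congr 1
      simp only [hw]
      rw [indicator_indicator, inter_eq_right.2 (hsub k)]
    have hle : ∀ k, ∫⁻ x, w k x ≤ F r₀ := fun k => by
      rw [← hint k]
      exact lintegral_mono (hwv k)
    have hlim : Tendsto (fun k => ∫⁻ x in {x : Plane | r₀ < ‖x‖ ∧ ‖x‖ < r}, w k x) atTop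
        (𝓝 (F r₀)) := by
      refine lintegral_tendsto_of_tendsto_of_monotone (fun k => (mw k).aemeasurable)
        (.of_forall fun x m n hmn => ?_) ((ae_restrict_iff' (mann r₀)).2 (.of_forall fun x hx => ?_))
      · have h1 : min (v x) (m : ℝ≥0∞) ≤ min (v x) n := min_le_min le_rfl (by exact_mod_cast hmn)
        have h2 : {x : Plane | 1 / ((m : ℝ) + 1) < ‖x‖ ∧ ‖x‖ < r} ⊆
            {x : Plane | 1 / ((n : ℝ) + 1) < ‖x‖ ∧ ‖x‖ < r} :=
          fun y hy => ⟨lt_of_le_of_lt (by gcongr) hy.1, hy.2⟩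
        exact (indicator_le_indicator h1).trans
          (indicator_le_indicator_of_subset h2 (fun _ => zero_le) x)
      · have h1 : Tendsto (fun n : ℕ => min (v x) n) atTop (𝓝 (min (v x) ⊤)) :=
          tendsto_const_nhds.min ENNReal.tendsto_nat_nhds_top
        rw [min_top_right] at h1
        refine h1.congr' ?_
        obtain ⟨N, hN⟩ := exists_nat_one_div_lt (h00.symm ▸ hx.1 : (0 : ℝ) < ‖x‖)
        filter_upwards [eventually_ge_atTop N] with n hn
        have h2 : x ∈ {x : Plane | 1 / ((n : ℝ) + 1) < ‖x‖ ∧ ‖x‖ < r} := by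
          refine ⟨lt_of_le_of_lt ?_ hN, hx.2⟩
          gcongr
        simp only [hw]
        rw [indicator_of_mem h2]
    have hlim2 := ENNReal.Tendsto.sub (tendsto_const_nhds (x := F r₀)) hlim (Or.inl hFfin)
    rw [tsub_self] at hlim2
    obtain ⟨k, hk⟩ := (hlim2.eventually (Iic_mem_nhds hη)).exists
    refine ⟨w k, r₀, 1 / ((k : ℝ) + 1), k, mw k, (hrad.min_const k).annulus_indicator _ _, hwv k,
      fun x => (indicator_le_self _ _ x).trans (min_le_right _ _), by positivity,
      fun x hx => indicator_of_notMem (fun h => hx.not_gt h.1) _,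
      fun x hx => indicator_of_notMem (fun h => hx.not_gt h.2) _, (hle k).trans hFr₀, h0, h0r, ?_,
      Or.inl h00.symm⟩
    rw [lintegral_sub (mw k) (by rw [hint k]; exact ((hle k).trans_lt hFfin.lt_top).ne)
      (.of_forall (hwv k))]
    exact hk
  · set s := r₀ / (1 + δ) with hs
    have hs0 : 0 < s := by positivity
    have hsr : s < r₀ := div_lt_self h0pos (by linarith)
    -- By minimality of `r₀`, any smaller inner radius captures more than `Θ`. Hence the shell `K`
    -- between `s` and `r₀` contains enough mass to fill up to `Θ`; `F s` may be infinite.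
    have hFs : Θ < F s := by
      by_contra! h
      exact hsr.not_ge (csInf_le hbdd ⟨hs0.le, h⟩)
    set E : Set Plane := {x | r₀ < ‖x‖ ∧ ‖x‖ < r} with hE
    set K : Set Plane := {x | s < ‖x‖ ∧ ‖x‖ < r} \ E with hK
    have mE : MeasurableSet E := mann r₀
    have mK : MeasurableSet K := (mann s).diff mE
    have hFsum : (∫⁻ x in E, v x) + ∫⁻ x in K, v x = F s := by
      have hEs : E ⊆ {x | s < ‖x‖ ∧ ‖x‖ < r} := fun x hx => ⟨hsr.trans hx.1, hx.2⟩
      rw [← lintegral_union mK disjoint_sdiff_right, union_sdiff_cancel hEs]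
    set A : ℕ → ℝ≥0∞ := fun k => ∫⁻ x in K, min (v x) k with hA
    set B : ℕ → ℝ≥0∞ := fun k => ∫⁻ x in E, min (v x) k with hB
    have limB : Tendsto B atTop (𝓝 (F r₀)) := tendsto_lintegral_min mv _
    have limA : Tendsto A atTop (𝓝 (∫⁻ x in K, v x)) := tendsto_lintegral_min mv _
    have limS : Tendsto (fun k => B k + A k) atTop (𝓝 (F s)) := hFsum ▸ limB.add limA
    have hlim2 := ENNReal.Tendsto.sub (tendsto_const_nhds (x := F r₀)) limB (Or.inl hFfin)
    rw [tsub_self] at hlim2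
    obtain ⟨k, hk1, hk2⟩ := ((hlim2.eventually (Iic_mem_nhds hη)).and
      (limS.eventually (lt_mem_nhds hFs))).exists
    have hBF : B k ≤ F r₀ := lintegral_mono fun x => min_le_left _ _
    have hBΘ : B k ≤ Θ := hBF.trans hFr₀
    have hA0 : A k ≠ 0 := fun h => by
      rw [h, add_zero] at hk2
      exact hk2.not_ge hBΘ
    have hAtop : A k ≠ ⊤ := by
      refine ne_top_of_le_ne_top (b := (k : ℝ≥0∞) * volume (Metric.ball (0 : Plane) r)) ?_ ?_
      · exact ENNReal.mul_ne_top (ENNReal.natCast_ne_top k) measure_ball_lt_top.ne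
      · calc A k ≤ ∫⁻ x in K, (k : ℝ≥0∞) := lintegral_mono fun x => min_le_right _ _
          _ = k * volume K := by rw [setLIntegral_const]
          _ ≤ _ := by
            gcongr
            exact fun x hx => by simpa using hx.1.2
    -- The fraction of the capped shell mass that brings the total to exactly `Θ`. It is at most `1`
    -- because the cap `k` was chosen with `B k + A k > Θ`.
    set l := (Θ - B k) / A k with hl
    have hl1 : l ≤ 1 := by
      refine ENNReal.div_le_of_le_mul ?_
      rw [one_mul]
      exact tsub_le_iff_left.2 hk2.le
    set w : Plane → ℝ≥0∞ := fun x => E.indicator (fun x => min (v x) k) x +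
      K.indicator (fun x => l * min (v x) k) x with hw
    have hwmin : ∀ x, w x ≤ min (v x) k := by
      intro x
      simp only [hw]
      by_cases hx : x ∈ E
      · rw [indicator_of_mem hx, indicator_of_notMem (fun h => h.2 hx), add_zero]
      · rw [indicator_of_notMem hx, zero_add]
        exact (indicator_le_self _ _ x).trans (mul_le_of_le_one_left' hl1)
    have hint : ∫⁻ x, w x = Θ := by
      simp only [hw]
      rw [lintegral_add_left ((mmin k).indicator mE), lintegral_indicator mE,
        lintegral_indicator mK, lintegral_const_mul _ (mmin k)]
      change B k + l * A k = Θ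
      rw [hl, ENNReal.div_mul_cancel hA0 hAtop, add_tsub_cancel_of_le hBΘ]
    have hout : ∀ x, ¬(s < ‖x‖ ∧ ‖x‖ < r) → w x = 0 := by
      intro x hx
      simp only [hw]
      rw [indicator_of_notMem (fun h => hx ⟨hsr.trans h.1, h.2⟩),
        indicator_of_notMem (fun h => hx h.1), add_zero]
    refine ⟨w, r₀, s, k, ((mmin k).indicator mE).add (((mmin k).const_mul l).indicator mK), ?_,
      fun x => (hwmin x).trans (min_le_left _ _), fun x => (hwmin x).trans (min_le_right _ _), hs0,
      fun x hx => hout x fun h => hx.not_gt h.1, fun x hx => hout x fun h => hx.not_gt h.2, hint.le,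
      h0, h0r, ?_, Or.inr ⟨h0pos, by rw [hs]; field_simp, hint⟩⟩
    · intro x y hxy
      have h1 : IsRadial (K.indicator fun x => l * min (v x) k) :=
        IsRadial.indicator (fun x y hxy => by simp only [hrad x y hxy]) fun x y hxy hx => by
          simpa only [hK, hE, Set.mem_sdiff, Set.mem_ofPred_eq, ← hxy] using hx
      exact congrArg₂ (· + ·) ((hrad.min_const k).annulus_indicator r₀ r x y hxy) (h1 x y hxy)
    · have : ∫⁻ x in E, (v x - w x) = ∫⁻ x in E, (v x - min (v x) k) := by
        refine setLIntegral_congr_fun mE fun x hx => ?_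
        simp only [hw]
        rw [indicator_of_mem hx, indicator_of_notMem (fun h => h.2 hx), add_zero]
      rw [this, lintegral_sub (mmin k) (hBF.trans_lt hFfin.lt_top).ne
        (.of_forall fun x => min_le_left _ _)]
      exact hk1

end Selection

/-! ### Comparison of the two scattering lengths and conclusion. -/

/-- The limit of the compactly supported bound: once the approximant agrees with `v` on `B(0, R)`,
the trial energy no longer depends on `n`. -/
theorem HasScatteringLength.two_pi_div_log_le_of_trial {v : Plane → ℝ≥0∞} {a R : ℝ}
    (hv : HasScatteringLength v a) (ha : 0 < a) (haR : a < R)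
    {p : ℝ → ℝ} (hp : Measurable p) {B : ℝ} (hB : ∀ t, |p t| ≤ B) {s : ℝ} (hs : 0 < s)
    (h0 : ∀ t ≤ s, p t = 0) :
    ENNReal.ofReal (2 * Real.pi / Real.log (R / a)) ≤
      (∫⁻ x in Metric.ball (0 : Plane) R, (‖(p ‖x‖ / ‖x‖) • x‖ₑ ^ 2 +
        (1 / 2) * v x * ‖1 - ∫ t in ‖x‖..R, p t‖ₑ ^ 2)) +
      ENNReal.ofReal (1 / Real.log (R / a) ^ 2) * ((1 / 2) *
        ∫⁻ x in {x : Plane | R < ‖x‖}, v x * ENNReal.ofReal (Real.log (‖x‖ / a) ^ 2)) := by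
  obtain ⟨V, α, hV, hVv, heq, hα, hlim⟩ := hv.exists_compact_approx
  have hR : 0 < R := ha.trans haR
  have hL : 0 < Real.log (R / a) := Real.log_pos ((one_lt_div ha).2 haR)
  have lim1 : Tendsto (fun n => ENNReal.ofReal (2 * Real.pi / Real.log (R / α n))) atTop
      (𝓝 (ENNReal.ofReal (2 * Real.pi / Real.log (R / a)))) :=
    ENNReal.tendsto_ofReal (tendsto_const_nhds.div
      ((tendsto_const_nhds.div hlim ha.ne').log (div_pos hR ha).ne') hL.ne')
  obtain ⟨N, hN⟩ := exists_nat_gt R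
  refine le_of_tendsto lim1 ?_
  filter_upwards [hlim.eventually (lt_mem_nhds ha), eventually_ge_atTop N] with n hn hNn
  refine ((hV n).two_pi_div_log_le_of_trial hn (hα n) haR hp hB hs h0).trans
    (add_le_add (le_of_eq ?_) ?_)
  · refine setLIntegral_congr_fun measurableSet_ball fun x hx => ?_
    have h1 : (N : ℝ) ≤ n := by exact_mod_cast hNn
    have h2 : ‖x‖ < n := lt_of_lt_of_le (by simpa using hx) (hN.le.trans h1)
    simp only [heq n x h2]
  · gcongr
    exact hVv n _

/-- If `L ≤ W - C`, then `1 / (W - C) - 1 / W = C / ((W - C) W) ≤ C / L²`. Otherwise `W - L < C`,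
and `1 / L - 1 / W = (W - L) / (L W) ≤ C / L²` holds without the trial bound. -/
theorem ofReal_two_pi_div_sub_le {L W C : ℝ} (hL : 0 < L) (hLW : L ≤ W) (hC : 0 ≤ C) (hCW : C < W)
    {X : ℝ≥0∞}
    (h : ENNReal.ofReal (2 * Real.pi / L) ≤ ENNReal.ofReal (2 * Real.pi / (W - C)) + X) :
    ENNReal.ofReal (2 * Real.pi / L - 2 * Real.pi / W) ≤
      ENNReal.ofReal (2 * Real.pi * C / L ^ 2) + X := by
  have hW := hL.trans_le hLW
  have hx : 0 < W - C := sub_pos.2 hCW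
  have hpi := Real.pi_pos
  rcases le_or_gt L (W - C) with h1 | h1
  · have e : 2 * Real.pi / (W - C) ≤ 2 * Real.pi / W + 2 * Real.pi * C / L ^ 2 := by
      have e1 : 2 * Real.pi / (W - C) = 2 * Real.pi / W + 2 * Real.pi * C / ((W - C) * W) := by
        field_simp
        ring
      rw [e1]
      gcongr
      nlinarith
    rw [ENNReal.ofReal_sub _ (by positivity), tsub_le_iff_left, ← add_assoc,
      ← ENNReal.ofReal_add (by positivity) (by positivity)]
    exact h.trans (add_le_add (ENNReal.ofReal_le_ofReal e) le_rfl)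
  · refine le_add_right (ENNReal.ofReal_le_ofReal ?_)
    have e1 : 2 * Real.pi / L - 2 * Real.pi / W = 2 * Real.pi * (W - L) / (L * W) := by
      field_simp
    rw [e1]
    gcongr
    · linarith
    · nlinarith

/-- The cut solution of `w` is the trial function for `v`. Since `log (R / a') = u R / h r`,
subtracting `c` from `u R` shifts the logarithm by `c / h r ≤ C`. -/
theorem IsRadialSolution.ofReal_two_pi_div_sub_le {q u h : ℝ → ℝ} {s r : ℝ}
    (hq : IsAnnularCoeff q s r) (hu : IsRadialSolution q s u h) {v w : Plane → ℝ≥0∞} {a a' R : ℝ}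
    (hv : HasScatteringLength v a) (ha : 0 < a) (haR : a < R) (hrR : r < R)
    (mw : Measurable w) (hwv : ∀ x, w x ≤ v x)
    (hw : ∀ x, (1 / 2) * w x = ENNReal.ofReal (q ‖x‖ / ‖x‖))
    (hw' : HasCompactScatteringLength w a') (hlog : Real.log (R / a') = u R / h r)
    {r₀ C η : ℝ} (hr₀ : r₀ ≤ r) (hC : 0 ≤ C)
    (h0 : r₀ = 0 ∨ 0 < h r ∧ u r₀ ≤ C * h r)
    (hη : (1 / 2) * ∫⁻ x in {x : Plane | r₀ < ‖x‖ ∧ ‖x‖ < R}, (v x - w x) ≤ ENNReal.ofReal η) :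
    ENNReal.ofReal (2 * Real.pi / Real.log (R / a) - 2 * Real.pi / Real.log (R / a')) ≤
      ENNReal.ofReal (2 * Real.pi * C / Real.log (R / a) ^ 2) + (ENNReal.ofReal η +
      ENNReal.ofReal (1 / Real.log (R / a) ^ 2) * ((1 / 2) *
        ∫⁻ x in {x : Plane | R < ‖x‖}, v x * ENNReal.ofReal (Real.log (‖x‖ / a) ^ 2))) := by
  have hR : 0 < R := ha.trans haR
  have hL : 0 < Real.log (R / a) := Real.log_pos ((one_lt_div ha).2 haR)
  have hH := hu.flux_nonneg hq r
  obtain ⟨c, hc0, hc, hc', hcC⟩ : ∃ c, 0 ≤ c ∧ c < u R ∧ (r₀ = 0 ∧ c = 0 ∨ c = u r₀) ∧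
      c ≤ C * h r := by
    rcases h0 with h0 | ⟨hHpos, h0⟩
    · exact ⟨0, le_rfl, hu.pos R, Or.inl ⟨h0, rfl⟩, mul_nonneg hC hH⟩
    · refine ⟨u r₀, (hu.pos _).le, ?_, Or.inr rfl, h0⟩
      -- Strict growth `u r₀ < u R` comes from the potential-free annulus between `r` and `R`, where
      -- `u` is logarithmic with slope `h r > 0`; `R / 2` keeps its inner radius positive.
      have hm : 0 < max r (R / 2) := lt_max_of_lt_right (by linarith)
      have hmR : max r (R / 2) < R := max_lt hrR (by linarith)
      have h1 := hu.sub_eq_log hq hm hR fun t ht => by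
        rw [uIcc_of_le hmR.le] at ht
        exact hu.flux_eq hq ((le_max_left _ _).trans ht.1)
      have h2 : 0 < Real.log (R / max r (R / 2)) := Real.log_pos ((one_lt_div hm).2 hmR)
      have h3 := hu.monotone (hr₀.trans (le_max_left r (R / 2)))
      nlinarith [mul_pos hHpos h2]
  have key := (hv.two_pi_div_log_le_of_trial ha haR (hu.measurable_cutSolutionDeriv hq r₀ c R)
    (hu.cutSolutionDeriv_bound hq hc) hq.pos (fun t ht => hu.cutSolutionDeriv_eq_zero hq ht)).trans
    (add_le_add (hu.lintegral_energy_cutSolution_le hq hR hrR.le (hr₀.trans hrR.le) hc hc0 hc' mw hw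
      (v := v)) le_rfl)
  rw [add_assoc] at key
  replace key := key.trans (add_le_add le_rfl (add_le_add hη le_rfl))
  rcases hH.eq_or_lt with hH0 | hHpos
  -- Without flux the trial energy of `w` is zero, and `2π / log (R / a')` is `0` by the convention
  -- for division by zero.
  · rw [← hH0, mul_zero, zero_div, ENNReal.ofReal_zero, zero_add] at key
    rw [hlog, ← hH0, div_zero, div_zero, sub_zero]
    exact key.trans le_add_self
  · have hW : 0 < Real.log (R / a') := by
      rw [hlog]
      exact div_pos (hu.pos R) hHpos
    have ha'0 : 0 < a' := hw'.nonneg.lt_of_ne fun h2 => by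
      rw [← h2] at hW
      simp at hW
    have hwR : VanishesBeyond w r := fun x hx => by
      have := hw x
      rw [hq.zero_of_ge _ hx, zero_div, ENNReal.ofReal_zero] at this
      simpa using this
    have ha'a : a' ≤ a := hw'.le_of_le hv hwv hwR
    have hLW : Real.log (R / a) ≤ Real.log (R / a') :=
      Real.log_le_log (by positivity) (by gcongr)
    have e : 2 * Real.pi * h r / (u R - c) = 2 * Real.pi / (Real.log (R / a') - c / h r) := by
      rw [hlog, ← sub_div]
      field_simp
    rw [e] at key
    refine (_root_.ofReal_two_pi_div_sub_le hL hLW (by positivity)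
      (by rw [hlog]; gcongr) key).trans ?_
    gcongr
    rwa [div_le_iff₀ hHpos]

theorem theorem3p5 (v : Plane → ℝ≥0∞) (hv : Measurable v) (hrad : IsRadial v)
    (a : ℝ) (ha : HasScatteringLength v a)
    (R T ε : ℝ) (hR : a < R) (hT : 0 < T) (hε : 0 < ε) :
    ∃ w : Plane → ℝ≥0∞, Measurable w ∧ IsRadial w ∧
      tsupport w ⊆ Metric.ball (0 : Plane) R ∧
      (∀ x, w x ≤ v x) ∧
      ∫⁻ x, w x ≤ ENNReal.ofReal (4 * Real.pi * T) ∧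
      ∃ a' : ℝ, HasScatteringLength w a' ∧
        ENNReal.ofReal
            (2 * Real.pi / Real.log (R / a) - 2 * Real.pi / Real.log (R / a')) ≤
          ENNReal.ofReal (1 / Real.log (R / a) ^ 2) *
            (ENNReal.ofReal (2 * Real.pi / T * (1 + ε)) +
              (1 / 2) * ∫⁻ x in {x : Plane | R < ‖x‖},
                v x * ENNReal.ofReal (Real.log (‖x‖ / a) ^ 2)) := by
  have hpi := Real.pi_pos
  rcases ha.nonneg.eq_or_lt with ha0 | ha0
  · obtain ⟨q, u, h, hq, hu, hw, -⟩ := exists_radialSolution_of_bounded (w := fun _ => 0)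
      measurable_const (fun _ _ _ => rfl) ENNReal.zero_ne_top (fun _ => le_rfl) one_pos zero_le_one
      (fun _ _ => rfl) (fun _ _ => rfl)
    obtain ⟨a', ha', -⟩ := hu.exists_scatteringLength hq hw
    have h1 : a' = 0 := le_antisymm
      (ha0 ▸ ha'.le_of_le (R := 0) ha (fun _ => zero_le) (fun _ _ => rfl)) ha'.nonneg
    refine ⟨fun _ => 0, measurable_const, fun _ _ _ => rfl, ?_, fun _ => zero_le, by simp, a',
      Or.inl ha', ?_⟩
    · have : tsupport (fun _ : Plane => (0 : ℝ≥0∞)) = ∅ := tsupport_eq_empty_iff.2 rfl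
      rw [this]
      exact empty_subset _
    · simp [h1, ← ha0]
  have hR0 : 0 < R := ha0.trans hR
  set L := Real.log (R / a) with hL
  have hL0 : 0 < L := Real.log_pos ((one_lt_div ha0).2 hR)
  -- Half of the allowance `2πε / (T L²)`. The other half pays for the thin shell through `δ = ε /
  -- (2T)`.
  set η : ℝ := Real.pi * ε / (T * L ^ 2) with hη
  have hη0 : 0 < η := by positivity
  obtain ⟨r₁, har₁, hr₁R⟩ := exists_between hR
  have hfin : ∫⁻ x in {x : Plane | r₁ < ‖x‖ ∧ ‖x‖ < R}, v x ≠ ⊤ := fun htop => by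
    have := ha.lintegral_annulus_le hv hrad ha0 har₁ hr₁R
    rw [htop, ENNReal.mul_top (by simp)] at this
    exact this.not_gt ENNReal.ofReal_lt_top
  obtain ⟨r, hr₁r, hrR, hr⟩ := exists_lintegral_outer_le hr₁R hfin (ENNReal.ofReal_pos.2 hη0)
  have hr0 : 0 < r := (ha0.trans har₁).trans hr₁r
  obtain ⟨w, r₀, s, k, mw, hwrad, hwv, hwk, hs, hws, hwr, hmass, hr₀, hr₀r, hin, hcase⟩ :=
    exists_truncation hv hrad hr0 (Θ := ENNReal.ofReal (4 * Real.pi * T)) ENNReal.ofReal_ne_top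
      (δ := ε / (2 * T)) (by positivity) (ENNReal.ofReal_pos.2 hη0)
  obtain ⟨q, u, h, hq, hu, hw, hm⟩ := exists_radialSolution_of_bounded mw hwrad
    (ENNReal.natCast_ne_top k) hwk hs hr0.le hws hwr
  obtain ⟨a', ha', hlog⟩ := hu.exists_scatteringLength hq hw
  refine ⟨w, mw, hwrad, ?_, hwv, hmass, a', Or.inl ha', ?_⟩
  · refine (closure_minimal (fun x hx => ?_) Metric.isClosed_closedBall).trans
      (Metric.closedBall_subset_ball hrR)
    rw [mem_closedBall_zero_iff]
    by_contra! hx'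
    exact hx (hwr x hx'.le)
  have hη' : (1 / 2) * ∫⁻ x in {x : Plane | r₀ < ‖x‖ ∧ ‖x‖ < R}, (v x - w x) ≤
      ENNReal.ofReal η := by
    have h1 : ∫⁻ x in {x : Plane | r₀ < ‖x‖ ∧ ‖x‖ < R}, (v x - w x) ≤ 2 * ENNReal.ofReal η := by
      calc _ ≤ ∫⁻ x in {x : Plane | r₀ < ‖x‖ ∧ ‖x‖ < r} ∪ {x : Plane | r ≤ ‖x‖ ∧ ‖x‖ < R},
            (v x - w x) := by
            refine lintegral_mono_set fun x hx => ?_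
            rcases lt_or_ge ‖x‖ r with h1 | h1
            · exact Or.inl ⟨hx.1, h1⟩
            · exact Or.inr ⟨h1, hx.2⟩
        _ ≤ _ := lintegral_union_le _ _ _
        _ ≤ _ := by
            rw [two_mul]
            exact add_le_add hin ((lintegral_mono fun x => tsub_le_self).trans hr)
    calc _ ≤ 1 / 2 * (2 * ENNReal.ofReal η) := by gcongr
      _ = _ := by
        rw [← mul_assoc, ENNReal.div_mul_cancel (by simp) (by simp), one_mul]
  have h0 : r₀ = 0 ∨ 0 < h r ∧ u r₀ ≤ (1 / T + ε / (2 * T)) * h r := by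
    rcases hcase with h0 | ⟨hr₀pos, hr₀s, hmass'⟩
    · exact Or.inl h0
    · right
      -- The mass is exactly `4πT`, and half of it is at most `2π h r`.
      have hTH : T ≤ h r := by
        rw [hmass', show (1 / 2 : ℝ≥0∞) = ENNReal.ofReal (1 / 2) by
          rw [ENNReal.ofReal_div_of_pos (by norm_num)]; simp,
          ← ENNReal.ofReal_mul (by norm_num)] at hm
        have := (ENNReal.ofReal_le_ofReal_iff'.1 hm).resolve_right
          (not_le.2 (by positivity))
        nlinarith
      have hH : 0 < h r := hT.trans_le hTH
      refine ⟨hH, ?_⟩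
      have hδ : 0 < ε / (2 * T) := by positivity
      have h1 := hu.sub_le_log hq hs (b := r₀) (by rw [hr₀s]; nlinarith)
      have h2 : r₀ / s = 1 + ε / (2 * T) := by rw [hr₀s]; field_simp
      have h3 : Real.log (1 + ε / (2 * T)) ≤ ε / (2 * T) :=
        (Real.log_le_sub_one_of_pos (by positivity)).trans (by linarith)
      rw [hu.eq_one s le_rfl, h2] at h1
      have h4 : 1 ≤ 1 / T * h r := by
        rw [one_div_mul_eq_div, one_le_div hT]
        exact hTH
      -- `u r₀ ≤ 1 + h r * log (1 + δ)`, where `1 ≤ h r / T` and `log (1 + δ) ≤ δ`.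
      nlinarith [mul_le_mul_of_nonneg_left h3 hH.le]
  refine (hu.ofReal_two_pi_div_sub_le hq ha ha0 hR hrR mw hwv hw ha' (hlog R hR0 hrR.le) hr₀r
    (by positivity) h0 hη').trans_eq ?_
  rw [mul_add (ENNReal.ofReal _), ← add_assoc, ← ENNReal.ofReal_add (by positivity) hη0.le,
    ← ENNReal.ofReal_mul (by positivity)]
  congr 2
  rw [hη, hL]
  field_simp
  ring
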